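/- Let $n,\ell,m$ be non-negative integers with $n\ge 32\ell$ and $0\le m\le\binom n2-\binom{n-\ell}2$. Order the $2$-element subsets of $[n]=\{1,\dots,n\}$ lexicographically, i.e. $A<B$ if and only if $A\neq B$ and $\min(A\,\triangle\,B)\in A$, and let $\mathcal L_{n,2}(m)$ be the graph on $[n]$ whose edges are the first $m$ of these $2$-element subsets. For a graph $G$ on $[n]$ (regarded as a set of $2$-element subsets of $[n]$) and $p\in[0,1]$, let $G_p$ be the random subset of edges of $G$ obtained by retaining each edge independently with probability $p$; a set of edges is called intersecting if any two of its members have a common vertex. Then $\mathcal L_{n,2}(m)$ has exactly $m$ edges, and for every $p\in[0,1]$ and every graph $G$ on $[n]$ with $m$ edges, $$\mathbb P\big(G_p\text{ is intersecting}\big)\;\le\;\mathbb P\big(\mathcal L_{n,2}(m)_p\text{ is intersecting}\big).$$ -/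

import Mathlib

open scoped symmDiff

/-- The lexicographic order on finite sets: `A` comes before `B` if the smallest element of the
symmetric difference of `A` and `B` exists and belongs to `A`. -/
def LexLT {α : Type*} [LinearOrder α] (A B : Finset α) : Prop :=
  ∃ a ∈ A ∆ B, (∀ b ∈ A ∆ B, a ≤ b) ∧ a ∈ A

open scoped Classical in
/-- The family of the first `m` of the `k`-element subsets of `[n]` (modelled by the linearly ordered
set `Fin n`) in the lexicographic order: those `k`-sets that have fewer than `m` predecessors among
the `k`-sets. -/
noncomputable def lexFamily (n k m : ℕ) : Finset (Finset (Fin n)) :=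
  {A ∈ Finset.powersetCard k (Finset.univ : Finset (Fin n)) |
    (Finset.filter (fun B => LexLT B A)
      (Finset.powersetCard k (Finset.univ : Finset (Fin n)))).card < m}

/-- The probability that the random subfamily of `F`, obtained by keeping each member of `F`
independently with probability `p`, is intersecting (any two of its members meet).
`ProbabilityTheory.setBernoulli` is the law of that random subfamily. -/
noncomputable def probIntersecting {n : ℕ} (F : Finset (Finset (Fin n))) (p : unitInterval) : ℝ :=
  (ProbabilityTheory.setBernoulli (F : Set (Finset (Fin n))) p).real
    {G : Set (Finset (Fin n)) | G.Intersecting}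

/-- `F` is a `k`-uniform family on `[n]` with `m` members. For `k = 2` these are the (edge sets of)
simple graphs on `[n]` with `m` edges. -/
def IsUniformOfSize {n : ℕ} (k m : ℕ) (F : Finset (Finset (Fin n))) : Prop :=
  (∀ A ∈ F, A.card = k) ∧ F.card = m

/-- `F` is a most probably intersecting `k`-uniform family on `[n]` with `m` members, for the
probability `p`. -/
def IsMostProbablyIntersecting {n : ℕ} (k m : ℕ) (p : unitInterval)
    (F : Finset (Finset (Fin n))) : Prop :=
  IsUniformOfSize k m F ∧
    ∀ F' : Finset (Finset (Fin n)), IsUniformOfSize k m F' →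
      probIntersecting F' p ≤ probIntersecting F p

/-!
The probability that a random subfamily of a family `F` of `m` pairs is intersecting is the sum over
`k` of `p ^ k * (1 - p) ^ (m - k)` times the number of intersecting subfamilies of `F` with `k` members
(`probIntersecting_eq_sum`). So it suffices that for every `k` the initial segment of the lexicographic
order maximises that number. This is trivial for `k ≤ 1`. For `2 ≤ k` an intersecting family of `k`
pairs is a star or, when `k = 3`, possibly a triangle (`star_or_triangle`), so the number is
`∑ v, (deg v).choose k`, plus the number of triangles if `k = 3`. This quantity is `numStars`.

The extremal theorem `numStars_le_lexStars` goes by induction on the number `h` of full centres of the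
lexicographic graph, the vertices joined to all others. If the competing graph `G` has a vertex joined
to all others, that vertex is deleted from both graphs; by Pascal's rule the counts satisfy the same
recursion (`numStars_cone`, `lexStars_succ`). The case `h = 0` is `numStars_le_choose`, since a star
attains the trivial bound.

Otherwise `G` is improved by three moves, none of which lowers the counts: an edge `uw` is shifted to
`vw` if `v` has at least the degree of `u`; an edge `xy` is traded for an edge between a vertex of
maximum degree and an isolated vertex, if that degree is large enough; and several edges between a
centre `c` and leaves of `c` are traded for a new vertex joined to the other centres. The last move can
preserve the number of cherries exactly, which is why progress is measured by the number of cherries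
and then by the number of nonisolated vertices (`Improves`). A graph that no move improves has nested
neighbourhoods. Without a vertex joined to all others it has an isolated vertex
(`exists_isolated_of_stuck`), and then it is nearly complete on few vertices: all its edges meet a
clique of `K` vertices, and its degrees are below `3 K` (`exists_clique_of_stuck`). With `m` edges it
has at most `m (m / K + 2 K) / 2` cherries (`cherries_le_of_clique_cover`). This is of order
`m ^ (3 / 2)`, whereas the lexicographic graph has about `m n / 2` cherries; the hypothesis that `m` is
at most about `n ^ 2 / 32` gives enough room to conclude (`cherries_numerics`,
`larger_stars_numerics`).
-/

/-! ### Adding and deleting stars -/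

section StarCounts
open Finset
open scoped Classical

variable {V : Type*}

/-- The graph obtained from `G` by joining the vertex `x` to all vertices of `Y` other than `x`. -/
def addStar (G : SimpleGraph V) (x : V) (Y : Finset V) : SimpleGraph V where
  Adj a b := G.Adj a b ∨ a ≠ b ∧ (a = x ∧ b ∈ Y ∨ b = x ∧ a ∈ Y)
  symm := ⟨fun a b h => by
    rcases h with h | ⟨h, h'⟩
    · exact Or.inl h.symm
    · exact Or.inr ⟨h.symm, h'.symm⟩⟩
  loopless := ⟨fun a h => by
    rcases h with h | ⟨h, -⟩
    · exact G.loopless.irrefl a h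
    · exact h rfl⟩

/-- The graph obtained from `G` by deleting all edges between the vertex `x` and the set `Y`. -/
def delStar (G : SimpleGraph V) (x : V) (Y : Finset V) : SimpleGraph V where
  Adj a b := G.Adj a b ∧ ¬ (a = x ∧ b ∈ Y) ∧ ¬ (b = x ∧ a ∈ Y)
  symm := ⟨fun _ _ h => ⟨h.1.symm, h.2.2, h.2.1⟩⟩
  loopless := ⟨fun a h => G.loopless.irrefl a h.1⟩

variable {G : SimpleGraph V} {x : V} {Y : Finset V}

lemma addStar_delStar (h : ∀ y ∈ Y, G.Adj x y) : addStar (delStar G x Y) x Y = G := by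
  ext a b
  simp only [addStar, delStar]
  constructor
  · rintro (h1 | ⟨-, ⟨rfl, hb⟩ | ⟨rfl, ha⟩⟩)
    · exact h1.1
    · exact h _ hb
    · exact (h _ ha).symm
  · intro hab
    have := hab.ne
    by_cases h1 : a = x ∧ b ∈ Y
    · exact Or.inr ⟨this, Or.inl h1⟩
    by_cases h2 : b = x ∧ a ∈ Y
    · exact Or.inr ⟨this, Or.inr h2⟩
    exact Or.inl ⟨hab, h1, h2⟩

lemma not_adj_delStar {y : V} (hy : y ∈ Y) : ¬ (delStar G x Y).Adj x y :=
  fun h => h.2.1 ⟨rfl, hy⟩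

lemma notMem_of_forall_adj (h : ∀ y ∈ Y, G.Adj x y) : x ∉ Y := fun hx => G.loopless.irrefl x (h x hx)

/-- All edges of `G` lie inside `U`. -/
def SupportedOn (G : SimpleGraph V) (U : Finset V) : Prop := ∀ a b, G.Adj a b → a ∈ U

lemma SupportedOn.delStar {U : Finset V} (h : SupportedOn G U) : SupportedOn (delStar G x Y) U :=
  fun a b hab => h a b hab.1

lemma SupportedOn.addStar {U : Finset V} (h : SupportedOn G U) (hx : x ∈ U) (hY : Y ⊆ U) :
    SupportedOn (addStar G x Y) U := by
  rintro a b (hab | ⟨-, ⟨rfl, -⟩ | ⟨-, ha⟩⟩)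
  · exact h a b hab
  · exact hx
  · exact hY ha

variable [Fintype V]

/-- The number of stars with `k` edges in `G` (each counted at its centre), plus `ε` times the number
of triangles of `G`. For `2 ≤ k` and `ε = 0` (or `k = 3` and `ε = 1`) this counts the intersecting
sets of `k` edges. -/
noncomputable def numStars (k ε : ℕ) (G : SimpleGraph V) : ℕ :=
  ∑ v, (G.degree v).choose k + ε * #(G.cliqueFinset 3)

/-- The sum of all degrees, which is twice the number of edges. -/
noncomputable def degreeSum (G : SimpleGraph V) : ℕ := ∑ v, G.degree v

lemma degree_congr {G H : SimpleGraph V} (h : G = H) (v : V) : G.degree v = H.degree v := by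
  subst h
  rfl

lemma degree_addStar_center (hx : x ∉ Y) (hY : ∀ y ∈ Y, ¬ G.Adj x y) :
    (addStar G x Y).degree x = G.degree x + #Y := by
  rw [← SimpleGraph.card_neighborFinset_eq_degree, ← SimpleGraph.card_neighborFinset_eq_degree,
    ← card_union_of_disjoint]
  · congr 1
    ext b
    simp only [SimpleGraph.mem_neighborFinset, mem_union]
    constructor
    · rintro (h | ⟨-, ⟨-, h⟩ | ⟨-, h⟩⟩)
      · exact Or.inl h
      · exact Or.inr h
      · exact absurd h hx
    · rintro (h | h)
      · exact Or.inl h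
      · exact Or.inr ⟨fun e => hx (e ▸ h), Or.inl ⟨rfl, h⟩⟩
  · rw [disjoint_left]
    intro b hb hbY
    exact hY b hbY (by simpa using hb)

lemma degree_addStar_leaf (hx : x ∉ Y) (hY : ∀ y ∈ Y, ¬ G.Adj x y) {y : V} (hy : y ∈ Y) :
    (addStar G x Y).degree y = G.degree y + 1 := by
  have hyx : y ≠ x := fun e => hx (e ▸ hy)
  rw [← SimpleGraph.card_neighborFinset_eq_degree, ← SimpleGraph.card_neighborFinset_eq_degree,
    ← card_insert_of_notMem (a := x) (s := G.neighborFinset y)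
      (by simpa using fun h : G.Adj y x => hY y hy h.symm)]
  congr 1
  ext b
  simp only [SimpleGraph.mem_neighborFinset, mem_insert]
  constructor
  · rintro (h | ⟨-, ⟨h, -⟩ | ⟨h, -⟩⟩)
    · exact Or.inr h
    · exact absurd h hyx
    · exact Or.inl h
  · rintro (rfl | h)
    · exact Or.inr ⟨hyx, Or.inr ⟨rfl, hy⟩⟩
    · exact Or.inl h

lemma degree_addStar_other {v : V} (hvx : v ≠ x) (hvY : v ∉ Y) :
    (addStar G x Y).degree v = G.degree v := by
  rw [← SimpleGraph.card_neighborFinset_eq_degree, ← SimpleGraph.card_neighborFinset_eq_degree]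
  congr 1
  ext b
  simp only [SimpleGraph.mem_neighborFinset]
  constructor
  · rintro (h | ⟨-, ⟨h, -⟩ | ⟨-, h⟩⟩)
    · exact h
    · exact absurd h hvx
    · exact absurd h hvY
  · exact Or.inl

/-- The effect of adding a star on the number of stars: the leaves gain by Pascal's rule. -/
lemma sum_choose_addStar (hx : x ∉ Y) (hY : ∀ y ∈ Y, ¬ G.Adj x y) (k : ℕ) :
    ∑ v, ((addStar G x Y).degree v).choose (k + 1) + (G.degree x).choose (k + 1) =
      ∑ v, (G.degree v).choose (k + 1) + (G.degree x + #Y).choose (k + 1) +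
        ∑ y ∈ Y, (G.degree y).choose k := by
  have key : ∀ v, ((addStar G x Y).degree v).choose (k + 1) +
      (if v = x then (G.degree x).choose (k + 1) else 0) =
      (G.degree v).choose (k + 1) + (if v = x then (G.degree x + #Y).choose (k + 1) else 0) +
      (if v ∈ Y then (G.degree v).choose k else 0) := by
    intro v
    by_cases hvx : v = x
    · subst hvx
      rw [degree_addStar_center hx hY]
      simp [hx]
      ring
    by_cases hvY : v ∈ Y
    · rw [degree_addStar_leaf hx hY hvY, Nat.choose_succ_succ]
      simp [hvx, hvY]
      ring
    · rw [degree_addStar_other hvx hvY]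
      simp [hvx, hvY]
  have := Finset.sum_congr (rfl : (univ : Finset V) = univ) fun v _ => key v
  simpa [sum_add_distrib, ← sum_filter] using this

lemma degreeSum_addStar (hx : x ∉ Y) (hY : ∀ y ∈ Y, ¬ G.Adj x y) :
    degreeSum (addStar G x Y) = degreeSum G + 2 * #Y := by
  have := sum_choose_addStar hx hY 0
  simp at this
  simp only [degreeSum]
  omega

lemma card_triangles_le_addStar :
    #(G.cliqueFinset 3) ≤ #((addStar G x Y).cliqueFinset 3) :=
  card_le_card (SimpleGraph.cliqueFinset_mono _ (fun _ _ h => Or.inl h))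

lemma card_triangles_addStar_le (hx : x ∉ Y) :
    #((addStar G x Y).cliqueFinset 3) ≤ #(G.cliqueFinset 3) + ∑ y ∈ Y, G.degree y := by
  have hsub : (addStar G x Y).cliqueFinset 3 ⊆ G.cliqueFinset 3 ∪
      Y.biUnion fun y => (G.neighborFinset y).image fun w => {x, y, w} := by
    intro s hs
    rw [SimpleGraph.mem_cliqueFinset_iff, SimpleGraph.is3Clique_iff] at hs
    obtain ⟨a, b, c, hab, hac, hbc, rfl⟩ := hs
    have key : ∀ a b c, (addStar G x Y).Adj a b → (addStar G x Y).Adj a c →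
        (addStar G x Y).Adj b c → (a = x ∧ b ∈ Y) →
        ∃ y ∈ Y, ∃ w, G.Adj y w ∧ ({x, y, w} : Finset V) = {a, b, c} := by
      rintro a b c hab hac hbc ⟨rfl, hb⟩
      refine ⟨b, hb, c, ?_, rfl⟩
      rcases hbc with h | ⟨-, ⟨rfl, -⟩ | ⟨rfl, -⟩⟩
      · exact h
      · exact absurd hb hx
      · exact absurd rfl hac.ne
    simp only [mem_union, mem_biUnion, mem_image, SimpleGraph.mem_neighborFinset,
      SimpleGraph.mem_cliqueFinset_iff, SimpleGraph.is3Clique_iff]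
    by_cases h : ∃ y ∈ Y, ∃ w, G.Adj y w ∧ ({x, y, w} : Finset V) = {a, b, c}
    · exact Or.inr h
    left
    have h1 : G.Adj a b := by
      rcases id hab with h' | ⟨-, h' | h'⟩
      · exact h'
      · exact absurd (key a b c hab hac hbc h') h
      · exact absurd (by simpa [insert_comm] using key b a c hab.symm hbc hac h') h
    have h2 : G.Adj a c := by
      rcases id hac with h' | ⟨-, h' | h'⟩
      · exact h'
      · refine absurd ?_ h
        have := key a c b hac hab hbc.symm h'
        rwa [show ({a, c, b} : Finset V) = {a, b, c} by ext; simp; tauto] at this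
      · refine absurd ?_ h
        have := key c a b hac.symm hbc.symm hab h'
        rwa [show ({c, a, b} : Finset V) = {a, b, c} by ext; simp; tauto] at this
    have h3 : G.Adj b c := by
      rcases id hbc with h' | ⟨-, h' | h'⟩
      · exact h'
      · refine absurd ?_ h
        have := key b c a hbc hab.symm hac.symm h'
        rwa [show ({b, c, a} : Finset V) = {a, b, c} by ext; simp; tauto] at this
      · refine absurd ?_ h
        have := key c b a hbc.symm hac.symm hab.symm h'
        rwa [show ({c, b, a} : Finset V) = {a, b, c} by ext; simp; tauto] at this
    exact ⟨a, b, c, h1, h2, h3, rfl⟩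
  refine (card_le_card hsub).trans ((card_union_le _ _).trans ?_)
  gcongr
  refine card_biUnion_le.trans (sum_le_sum fun y _ => ?_)
  exact card_image_le.trans (by simp)

/-- A vertex joined to everything else lies in one triangle for each of the other edges. -/
lemma card_triangles_cone (hx : x ∉ Y) (hG : ∀ a b, G.Adj a b → a ∈ Y) :
    2 * #((addStar G x Y).cliqueFinset 3) = 2 * #(G.cliqueFinset 3) + degreeSum G := by
  have hGx : ∀ a, ¬ G.Adj x a := fun a h => hx (hG _ _ h)
  have hGx' : ∀ a, ¬ G.Adj a x := fun a h => hx (hG _ _ h.symm)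
  have heq : (addStar G x Y).cliqueFinset 3 = G.cliqueFinset 3 ∪
      G.edgeFinset.image fun e => insert x e.toFinset := by
    ext s
    simp only [mem_union, mem_image, SimpleGraph.mem_cliqueFinset_iff, SimpleGraph.mem_edgeFinset]
    constructor
    · intro hs
      by_cases hxs : x ∈ s
      · right
        have key : ∀ b c, (addStar G x Y).Adj x b → (addStar G x Y).Adj x c →
            (addStar G x Y).Adj b c → ∃ e ∈ G.edgeSet, insert x e.toFinset = {x, b, c} := by
          intro b c hb hc hbc
          refine ⟨s(b, c), ?_, by ext; simp⟩
          rcases hbc with h | ⟨-, ⟨rfl, -⟩ | ⟨rfl, -⟩⟩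
          · exact h
          · exact absurd rfl hb.ne
          · exact absurd rfl hc.ne
        obtain ⟨a, b, c, hab, hac, hbc, rfl⟩ := SimpleGraph.is3Clique_iff.1 hs
        simp only [mem_insert, mem_singleton] at hxs
        rcases hxs with rfl | rfl | rfl
        · exact key _ _ hab hac hbc
        · rw [insert_comm]
          exact key _ _ hab.symm hbc hac
        · rw [pair_comm b, insert_comm a]
          exact key _ _ hac.symm hbc.symm hab
      · left
        rw [SimpleGraph.is3Clique_iff] at hs ⊢
        obtain ⟨a, b, c, hab, hac, hbc, rfl⟩ := hs
        simp only [mem_insert, mem_singleton, not_or] at hxs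
        simp only [addStar] at hab hac hbc
        exact ⟨a, b, c, by grind, by grind, by grind, rfl⟩
    · rintro (hs | ⟨e, he, rfl⟩)
      · exact hs.mono (fun _ _ h => Or.inl h)
      · induction e with | h a b => ?_
        rw [SimpleGraph.mem_edgeSet] at he
        rw [SimpleGraph.is3Clique_iff]
        refine ⟨x, a, b, ?_, ?_, Or.inl he, ?_⟩
        · exact Or.inr ⟨fun e => hGx b (e ▸ he), Or.inl ⟨rfl, hG _ _ he⟩⟩
        · exact Or.inr ⟨fun e => hGx a (e ▸ he.symm), Or.inl ⟨rfl, hG _ _ he.symm⟩⟩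
        · ext; simp
  rw [heq, card_union_of_disjoint, card_image_of_injOn, degreeSum,
    G.sum_degrees_eq_twice_card_edges, mul_add]
  · intro e he f hf hef
    have hxe : ∀ e ∈ G.edgeFinset, x ∉ e.toFinset := by
      intro e he hxe
      rw [SimpleGraph.mem_edgeFinset] at he
      rw [Sym2.mem_toFinset] at hxe
      obtain ⟨a, rfl⟩ := hxe
      exact hGx _ he
    have := congrArg (fun s => s.erase x) hef
    simp only [erase_insert (hxe e he), erase_insert (hxe f hf)] at this
    ext a
    rw [← Sym2.mem_toFinset, this, Sym2.mem_toFinset]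
  · rw [disjoint_left]
    intro s hs hs'
    obtain ⟨e, -, rfl⟩ := mem_image.1 hs'
    rw [SimpleGraph.mem_cliqueFinset_iff, SimpleGraph.is3Clique_iff] at hs
    obtain ⟨a, b, c, hab, hac, hbc, h⟩ := hs
    have : x ∈ ({a, b, c} : Finset V) := h ▸ mem_insert_self _ _
    simp only [mem_insert, mem_singleton] at this
    rcases this with rfl | rfl | rfl
    · exact hGx _ hab
    · exact hGx _ hbc
    · exact hGx' _ hbc

end StarCounts

/-! ### Moves that do not lose stars -/

section Moves
open Finset
open scoped Classical

/-- The gain from a new edge at a vertex of degree `a + b` outweighs the loss of an edge whose ends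
have `a` and `b` other neighbours. The term `ε * b` bounds the triangles through that edge. -/
lemma choose_add_choose_add_le {a b j ε : ℕ} (ha : 1 ≤ a) (hε : ε = 0 ∨ ε = 1 ∧ j = 1) :
    a.choose (j + 1) + b.choose (j + 1) + ε * b ≤ (a + b).choose (j + 1) := by
  rw [add_assoc]
  induction b with
  | zero => simp
  | succ b ih =>
    have h1 : b.choose j + ε ≤ (a + b).choose j := by
      rcases hε with rfl | ⟨rfl, rfl⟩
      · exact Nat.choose_le_choose _ (by omega)
      · simp; omega
    have h2 := Nat.choose_succ_succ (a + b) j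
    have h3 := Nat.choose_succ_succ b j
    simp only [Nat.succ_eq_add_one] at h2 h3
    rw [← add_assoc a b 1]
    linarith [mul_add ε b 1]

/-- The gain from a new edge at a vertex of degree `d` outweighs the loss of an edge at a vertex with
`b < d` other neighbours, triangles included. -/
lemma choose_add_le {b d j ε : ℕ} (hb : b + 1 ≤ d) (hε : ε = 0 ∨ ε = 1 ∧ j = 1) :
    b.choose (j + 1) + ε * b ≤ d.choose (j + 1) := by
  refine le_trans ?_ (Nat.choose_le_choose (j + 1) hb)
  rw [Nat.choose_succ_succ]
  rcases hε with rfl | ⟨rfl, rfl⟩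
  · simp
  · simp; omega

/-- The sum of `(p + i).choose (j + 1)` over `i < t` lies below `t * (p + t).choose (j + 1)` by at least
`t (t + 1) / 2` times `p.choose j`. -/
lemma choose_window (p j t : ℕ) :
    2 * (p + t).choose (j + 2) + t * (t + 1) * p.choose j ≤
      2 * p.choose (j + 2) + 2 * t * (p + t).choose (j + 1) := by
  induction t with
  | zero => simp
  | succ t ih =>
    have h2 := Nat.choose_succ_succ (p + t) (j + 1)
    have h3 := Nat.choose_succ_succ (p + t) j
    have h4 : p.choose j ≤ (p + t).choose j := Nat.choose_le_choose _ (by omega)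
    simp only [Nat.succ_eq_add_one] at h2 h3
    rw [← add_assoc p t 1, h2, h3]
    nlinarith [Nat.mul_le_mul_left (2 * (t + 1)) h4]

/-- The numerical heart of the relocation move: `s` edges at a vertex of degree `p + s`, with leaves
of degree `s + 1`, may be exchanged for a new vertex joined to `s` vertices of degree at least
`p + s`. For `j = 0` and `p = s` this is an equality. -/
lemma choose_relocate {p s j ε : ℕ} (hps : s ≤ p) (hε : ε = 0 ∨ ε = 1 ∧ j = 1) :
    (p + s).choose (j + 2) + s * (s.choose (j + 1) + ε * s) ≤
      p.choose (j + 2) + s.choose (j + 2) + s * (p + s).choose (j + 1) := by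
  have h1 := choose_window p j s
  have h2 : s.choose j ≤ p.choose j := Nat.choose_le_choose _ hps
  have h3 : 2 * s * (s.choose (j + 1) + ε * s) ≤
      2 * s.choose (j + 2) + s * (s + 1) * s.choose j := by
    rcases j with _ | j
    · obtain rfl : ε = 0 := by omega
      rcases s with _ | s
      · simp
      · have h5 : 2 * (s + 1).choose 2 = (s + 1) * s := by
          rw [Nat.choose_two_right, Nat.add_sub_cancel, mul_comm 2]
          exact Nat.div_mul_cancel (by simpa [mul_comm] using (Nat.even_mul_succ_self s).two_dvd)
        simp [h5]
        nlinarith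
    · have h4 := Nat.choose_succ_right_eq s (j + 1)
      have h5 : 2 * s.choose (j + 2) ≤ s.choose (j + 1) * (s - (j + 1)) := by
        rw [← h4, mul_comm]
        exact Nat.mul_le_mul_left _ (by omega)
      have h6 : 2 * s.choose (j + 2) + 2 * ε * s ≤ s.choose (j + 1) * (s + 1) := by
        rcases Nat.eq_zero_or_pos s with rfl | hs
        · simp
        have h7 : 2 * s.choose (j + 2) ≤ s.choose (j + 1) * (s - 1) :=
          h5.trans (Nat.mul_le_mul_left _ (by omega))
        have h8 : s.choose (j + 1) * (s + 1) = s.choose (j + 1) * (s - 1) + 2 * s.choose (j + 1) := by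
          rw [show s + 1 = (s - 1) + 2 by omega]; ring
        have h9 : ε * s ≤ s.choose (j + 1) := by
          rcases hε with rfl | ⟨rfl, hj⟩
          · simp
          · obtain rfl : j = 0 := by omega
            simp
        rw [h8]
        linarith [mul_assoc 2 ε s]
      have := Nat.mul_le_mul_left s h6
      have e : j + 1 + 1 = j + 2 := rfl
      rw [e]
      nlinarith
  have h4 := Nat.mul_le_mul_left (s * (s + 1)) h2
  nlinarith

variable {V : Type*} [Fintype V] {G : SimpleGraph V} {x y : V} {Y : Finset V}

lemma numStars_addStar_le (hx : x ∉ Y) (hY : ∀ y ∈ Y, ¬ G.Adj x y) (k ε : ℕ) :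
    numStars (k + 1) ε (addStar G x Y) + (G.degree x).choose (k + 1) ≤
      numStars (k + 1) ε G + (G.degree x + #Y).choose (k + 1) +
        ∑ y ∈ Y, ((G.degree y).choose k + ε * G.degree y) := by
  have h1 := sum_choose_addStar hx hY k
  have h2 := Nat.mul_le_mul_left ε (card_triangles_addStar_le (G := G) hx)
  rw [mul_add, mul_sum] at h2
  rw [sum_add_distrib]
  unfold numStars
  linarith

lemma le_numStars_addStar (hx : x ∉ Y) (hY : ∀ y ∈ Y, ¬ G.Adj x y) (k ε : ℕ) :
    numStars (k + 1) ε G + (G.degree x + #Y).choose (k + 1) + ∑ y ∈ Y, (G.degree y).choose k ≤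
      numStars (k + 1) ε (addStar G x Y) + (G.degree x).choose (k + 1) := by
  have h1 := sum_choose_addStar hx hY k
  have h2 := Nat.mul_le_mul_left ε (card_triangles_le_addStar (G := G) (x := x) (Y := Y))
  unfold numStars
  linarith

lemma numStars_addEdge_le (hxy : x ≠ y) (hadj : ¬ G.Adj x y) (k ε : ℕ) :
    numStars (k + 1) ε (addStar G x {y}) ≤
      numStars (k + 1) ε G + (G.degree x).choose k + (G.degree y).choose k + ε * G.degree y := by
  have h := numStars_addStar_le (G := G) (x := x) (Y := {y}) (by simpa using hxy) (by simpa) k ε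
  have h2 := Nat.choose_succ_succ (G.degree x) k
  simp only [Nat.succ_eq_add_one] at h2
  simp only [card_singleton, sum_singleton, h2] at h
  linarith

lemma le_numStars_addEdge (hxy : x ≠ y) (hadj : ¬ G.Adj x y) (k ε : ℕ) :
    numStars (k + 1) ε G + (G.degree x).choose k + (G.degree y).choose k ≤
      numStars (k + 1) ε (addStar G x {y}) := by
  have h := le_numStars_addStar (G := G) (x := x) (Y := {y}) (by simpa using hxy) (by simpa) k ε
  have h2 := Nat.choose_succ_succ (G.degree x) k
  simp only [Nat.succ_eq_add_one] at h2
  simp only [card_singleton, sum_singleton, h2] at h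
  linarith

lemma degree_delStar_center (h : ∀ y ∈ Y, G.Adj x y) :
    (delStar G x Y).degree x + #Y = G.degree x := by
  have := degree_addStar_center (G := delStar G x Y) (notMem_of_forall_adj h)
    (fun y hy => not_adj_delStar hy)
  rw [← this, degree_congr (addStar_delStar h)]

lemma degree_delStar_leaf (h : ∀ y ∈ Y, G.Adj x y) (hy : y ∈ Y) :
    (delStar G x Y).degree y + 1 = G.degree y := by
  have := degree_addStar_leaf (G := delStar G x Y) (notMem_of_forall_adj h)
    (fun y hy => not_adj_delStar hy) hy
  rw [← this, degree_congr (addStar_delStar h)]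

lemma degree_delStar_other {v : V} (h : ∀ y ∈ Y, G.Adj x y) (hvx : v ≠ x) (hvY : v ∉ Y) :
    (delStar G x Y).degree v = G.degree v := by
  rw [← degree_addStar_other (G := delStar G x Y) hvx hvY, degree_congr (addStar_delStar h)]

lemma degreeSum_delStar (h : ∀ y ∈ Y, G.Adj x y) :
    degreeSum (delStar G x Y) + 2 * #Y = degreeSum G := by
  have := degreeSum_addStar (G := delStar G x Y) (notMem_of_forall_adj h)
    (fun y hy => not_adj_delStar hy)
  rw [addStar_delStar h] at this
  exact this.symm

/-- The vertices that are not isolated. -/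
noncomputable def nonisolated (G : SimpleGraph V) : Finset V := {v | 0 < G.degree v}

/-- `G'` is a graph inside `U` with as many edges as `G`, has at least as many stars with `k` edges
(and triangles, if `ε = 1`) and at least as many cherries, and beats `G` either in the number of
cherries or in the number of nonisolated vertices. -/
structure Improves (U : Finset V) (k ε : ℕ) (G G' : SimpleGraph V) : Prop where
  supportedOn : SupportedOn G' U
  degreeSum_eq : degreeSum G' = degreeSum G
  numStars_le : numStars k ε G ≤ numStars k ε G'
  cherries_le : numStars 2 0 G ≤ numStars 2 0 G'
  lt : numStars 2 0 G < numStars 2 0 G' ∨ #(nonisolated G) < #(nonisolated G')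

/-- Shifting an edge `uw` to an edge `vw` at a vertex `v` of at least the same degree. -/
lemma exists_improves_of_shift {U : Finset V} {j ε : ℕ} (hε : ε = 0 ∨ ε = 1 ∧ j = 1)
    (hG : SupportedOn G U) {u v w : V} (hvU : v ∈ U) (huv : G.degree u ≤ G.degree v)
    (huw : G.Adj u w) (hvw : ¬ G.Adj v w) (hne : v ≠ w) :
    ∃ G', Improves U (j + 2) ε G G' := by
  have hst : ∀ y ∈ ({u} : Finset V), G.Adj w y := by simpa using huw.symm
  have hvu : v ≠ u := by rintro rfl; exact hvw huw
  set G₀ := delStar G w {u} with hG₀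
  have hG₀v : ¬ G₀.Adj w v := fun h => hvw h.1.symm
  have hG₀u : ¬ G₀.Adj w u := not_adj_delStar (by simp)
  have hdv : G₀.degree v = G.degree v := degree_delStar_other hst hne (by simpa using hvu)
  have hdu : G₀.degree u + 1 = G.degree u := degree_delStar_leaf hst (by simp)
  have hadd : addStar G₀ w {u} = G := addStar_delStar hst
  have hle : ∀ (i ε' : ℕ), numStars (i + 1) ε' G ≤ numStars (i + 1) ε' G₀ +
      (G₀.degree w).choose i + (G₀.degree u).choose i + ε' * G₀.degree u := by
    intro i ε'
    have := numStars_addEdge_le (G := G₀) huw.ne' hG₀u i ε'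
    rwa [hadd] at this
  have hge := fun i ε' : ℕ => le_numStars_addEdge (G := G₀) hne.symm hG₀v i ε'
  have hlt : numStars 2 0 G < numStars 2 0 (addStar G₀ w {v}) := by
    have h1 := hle 1 0
    have h2 := hge 1 0
    simp only [Nat.choose_one_right] at h1 h2
    norm_num at h1 h2
    omega
  refine ⟨addStar G₀ w {v}, hG.delStar.addStar (hG _ _ huw.symm) (by simpa using hvU), ?_, ?_,
    hlt.le, Or.inl hlt⟩
  · rw [degreeSum_addStar (by simpa using hne.symm) (by simpa using hG₀v), ← degreeSum_delStar hst]
    simp [hG₀]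
  · have := choose_add_le (b := G₀.degree u) (d := G₀.degree v) (by omega) hε
    have h1 := hle (j + 1) ε
    have h2 := hge (j + 1) ε
    linarith

/-- Replacing an edge `xy` by an edge from a vertex `v` of large degree to an isolated vertex. -/
lemma exists_improves_of_edge {U : Finset V} {j ε : ℕ} (hε : ε = 0 ∨ ε = 1 ∧ j = 1)
    (hG : SupportedOn G U) {v x y z : V} (hxy : G.Adj x y) (hvx : G.Adj v x) (hvy : G.Adj v y)
    (hzU : z ∈ U) (hz : G.degree z = 0)
    (hd : G.degree x + G.degree y ≤ G.degree v + 2) :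
    ∃ G', Improves U (j + 2) ε G G' := by
  have hst : ∀ w ∈ ({y} : Finset V), G.Adj x w := by simpa using hxy
  have hpos : ∀ {a b}, G.Adj a b → 0 < G.degree a := fun {a b} h =>
    (G.degree_pos_iff_exists_adj a).2 ⟨b, h⟩
  have hzx : z ≠ x := by rintro rfl; exact (hpos hxy).ne' hz
  have hzy : z ≠ y := by rintro rfl; exact (hpos hxy.symm).ne' hz
  have hzv : v ≠ z := by rintro rfl; exact (hpos hvx).ne' hz
  set G₀ := delStar G x {y} with hG₀
  have hG₀v : ¬ G₀.Adj v z := fun h => (hpos h.1.symm).ne' hz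
  have hG₀y : ¬ G₀.Adj x y := not_adj_delStar (by simp)
  have hdv : G₀.degree v = G.degree v := degree_delStar_other hst hvx.ne (by simpa using hvy.ne)
  have hdz : G₀.degree z = 0 := by
    rw [← hz]; exact degree_delStar_other hst hzx (by simpa using hzy)
  have hdy : G₀.degree y + 1 = G.degree y := degree_delStar_leaf hst (by simp)
  have hdx : G₀.degree x + 1 = G.degree x := by simpa using degree_delStar_center hst
  have hx1 : 1 ≤ G₀.degree x := (G₀.degree_pos_iff_exists_adj x).2
    ⟨v, hvx.symm, by simpa using hvy.ne, by simpa using fun h : v = x => absurd h hvx.ne⟩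
  have hy1 : 1 ≤ G₀.degree y := (G₀.degree_pos_iff_exists_adj y).2
    ⟨v, hvy.symm, by simpa using fun _ => hvy.ne, by simpa using fun h : v = x => absurd h hvx.ne⟩
  have hadd : addStar G₀ x {y} = G := addStar_delStar hst
  have hle : ∀ (i ε' : ℕ), numStars (i + 1) ε' G ≤ numStars (i + 1) ε' G₀ +
      (G₀.degree x).choose i + (G₀.degree y).choose i + ε' * G₀.degree y := by
    intro i ε'
    have := numStars_addEdge_le (G := G₀) hxy.ne hG₀y i ε'
    rwa [hadd] at this
  have hge := fun i ε' : ℕ => le_numStars_addEdge (G := G₀) hzv hG₀v i ε'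
  have hnum : ∀ i ε', (ε' = 0 ∨ ε' = 1 ∧ i = 1) →
      numStars (i + 2) ε' G ≤ numStars (i + 2) ε' (addStar G₀ v {z}) := by
    intro i ε' h
    have h0 := choose_add_choose_add_le (b := G₀.degree y) hx1 h
    have h1 : (G₀.degree x + G₀.degree y).choose (i + 1) ≤ (G₀.degree v).choose (i + 1) :=
      Nat.choose_le_choose _ (by omega)
    have h2 := hle (i + 1) ε'
    have h3 := hge (i + 1) ε'
    linarith
  refine ⟨addStar G₀ v {z}, hG.delStar.addStar (hG _ _ hvx) (by simpa using hzU), ?_,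
    hnum j ε hε, hnum 0 0 (Or.inl rfl), Or.inr ?_⟩
  · rw [degreeSum_addStar (by simpa using hzv) (by simpa using hG₀v), ← degreeSum_delStar hst]
    simp [hG₀]
  · apply card_lt_card
    rw [ssubset_iff_of_subset]
    · refine ⟨z, ?_, by simp [nonisolated, hz]⟩
      simp only [nonisolated, mem_filter, mem_univ, true_and]
      rw [degree_addStar_leaf (by simpa using hzv) (by simpa using hG₀v) (by simp)]
      omega
    · intro a ha
      simp only [nonisolated, mem_filter, mem_univ, true_and] at ha ⊢
      have : 0 < G₀.degree a := by
        by_cases h1 : a = x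
        · rw [h1]; omega
        by_cases h2 : a = y
        · rw [h2]; omega
        rw [degree_delStar_other hst h1 (by simpa using h2)]
        exact ha
      refine this.trans_le (SimpleGraph.degree_le_of_le (fun _ _ h => Or.inl h))

/-- Exchanging `#A` edges between `c` and leaves of degree `#A + 1` for a new vertex joined to the
vertices of `A`, all of degree at least that of `c`. -/
lemma exists_improves_of_relocate {U : Finset V} {j ε : ℕ} (hε : ε = 0 ∨ ε = 1 ∧ j = 1)
    (hG : SupportedOn G U) {c z : V} {A : Finset V} (hY : ∀ y ∈ Y, G.Adj c y) (hcA : c ∉ A)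
    (hAY : Disjoint A Y) (hA : A.Nonempty) (hcard : #Y = #A)
    (hYdeg : ∀ y ∈ Y, G.degree y = #A + 1) (hAdeg : ∀ a ∈ A, G.degree c ≤ G.degree a)
    (hAU : A ⊆ U) (hzU : z ∈ U) (hz : G.degree z = 0) (hc : 2 * #A ≤ G.degree c) :
    ∃ G', Improves U (j + 2) ε G G' := by
  have hpos : ∀ {a b}, G.Adj a b → 0 < G.degree a := fun {a b} h =>
    (G.degree_pos_iff_exists_adj a).2 ⟨b, h⟩
  have hApos : 0 < #A := hA.card_pos
  set G₀ := delStar G c Y with hG₀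
  have hcY : c ∉ Y := notMem_of_forall_adj hY
  have hadd : addStar G₀ c Y = G := addStar_delStar hY
  have hG₀Y : ∀ y ∈ Y, ¬ G₀.Adj c y := fun y hy => not_adj_delStar hy
  have hzA : z ∉ A := fun h => by have := hAdeg z h; omega
  have hzY : z ∉ Y := fun h => by have := hYdeg z h; omega
  have hzc : z ≠ c := by rintro rfl; omega
  have hG₀A : ∀ a ∈ A, ¬ G₀.Adj z a := fun a _ h => (hpos h.1).ne' hz
  have hdz : G₀.degree z = 0 := by rw [← hz]; exact degree_delStar_other hY hzc hzY
  have hdc : G₀.degree c + #A = G.degree c := by rw [← hcard]; exact degree_delStar_center hY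
  have hdY : ∀ y ∈ Y, G₀.degree y = #A := fun y hy => by
    have h1 : G₀.degree y + 1 = G.degree y := degree_delStar_leaf hY hy
    have h2 := hYdeg y hy
    omega
  have hdA : ∀ a ∈ A, G₀.degree a = G.degree a := fun a ha =>
    degree_delStar_other hY (fun h => hcA (h ▸ ha)) (disjoint_left.1 hAY ha)
  have hnum : ∀ i ε', (ε' = 0 ∨ ε' = 1 ∧ i = 1) →
      numStars (i + 2) ε' G ≤ numStars (i + 2) ε' (addStar G₀ z A) := by
    intro i ε' h
    have h1 := numStars_addStar_le hcY hG₀Y (i + 1) ε'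
    have h2 := le_numStars_addStar hzA hG₀A (i + 1) ε'
    have h3 := choose_relocate (p := G₀.degree c) (s := #A) (by omega) h
    have h4 : ∑ y ∈ Y, ((G₀.degree y).choose (i + 1) + ε' * G₀.degree y) =
        #A * ((#A).choose (i + 1) + ε' * #A) := by
      rw [sum_congr rfl fun y hy => by rw [hdY y hy], sum_const, hcard, smul_eq_mul]
    have h5 : #A * (G₀.degree c + #A).choose (i + 1) ≤
        ∑ a ∈ A, (G₀.degree a).choose (i + 1) := by
      rw [← smul_eq_mul]
      refine card_nsmul_le_sum _ _ _ fun a ha => Nat.choose_le_choose _ ?_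
      rw [hdc, hdA a ha]
      exact hAdeg a ha
    rw [hadd, h4, hcard] at h1
    rw [hdz] at h2
    simp only [Nat.choose_zero_succ, zero_add] at h2
    linarith
  refine ⟨addStar G₀ z A, hG.delStar.addStar hzU hAU, ?_, hnum j ε hε, hnum 0 0 (Or.inl rfl),
    Or.inr ?_⟩
  · rw [degreeSum_addStar hzA hG₀A, ← degreeSum_delStar hY, hcard]
  · apply card_lt_card
    rw [ssubset_iff_of_subset]
    · refine ⟨z, ?_, by simp [nonisolated, hz]⟩
      simp only [nonisolated, mem_filter, mem_univ, true_and]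
      rw [degree_addStar_center hzA hG₀A]
      omega
    · intro a ha
      simp only [nonisolated, mem_filter, mem_univ, true_and] at ha ⊢
      have : 0 < G₀.degree a := by
        by_cases h1 : a = c
        · rw [h1]; omega
        by_cases h2 : a ∈ Y
        · rw [hdY a h2]; omega
        rw [degree_delStar_other hY h1 h2]
        exact ha
      refine this.trans_le (SimpleGraph.degree_le_of_le (fun _ _ h => Or.inl h))

end Moves

/-! ### Graphs that no move improves -/

section Stuck
open Finset
open scoped Classical

variable {V : Type*} [Fintype V] {G : SimpleGraph V}

/-- If `W` is a clique that meets all edges, the edges are counted by the degrees in `W`, those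
inside `W` twice. -/
lemma degreeSum_add_of_clique_cover {W : Finset V}
    (hclique : ∀ a ∈ W, ∀ b ∈ W, a ≠ b → G.Adj a b) (hcover : ∀ a b, G.Adj a b → a ∉ W → b ∈ W) :
    ∑ v ∈ Wᶜ, G.degree v + #W * (#W - 1) = ∑ w ∈ W, G.degree w := by
  have h1 : ∀ w ∈ W, G.degree w = #(Wᶜ.filter fun v => G.Adj v w) + (#W - 1) := by
    intro w hw
    rw [← card_erase_of_mem hw, ← G.card_neighborFinset_eq_degree,
      ← card_union_of_disjoint]
    · congr 1
      ext b
      simp only [SimpleGraph.mem_neighborFinset, mem_union, mem_filter, mem_compl, mem_erase]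
      constructor
      · intro h
        by_cases hb : b ∈ W
        · exact Or.inr ⟨h.ne', hb⟩
        · exact Or.inl ⟨hb, h.symm⟩
      · rintro (⟨-, h⟩ | ⟨h, hb⟩)
        · exact h.symm
        · exact hclique w hw b hb h.symm
    · rw [disjoint_left]
      intro b hb hb'
      simp only [mem_filter, mem_compl] at hb
      exact hb.1 (mem_of_mem_erase hb')
  have h2 : ∀ v ∈ Wᶜ, G.degree v = #(W.filter fun w => G.Adj v w) := by
    intro v hv
    rw [← G.card_neighborFinset_eq_degree]
    congr 1
    ext b
    simp only [SimpleGraph.mem_neighborFinset, mem_filter]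
    exact ⟨fun h => ⟨hcover v b h (mem_compl.1 hv), h⟩, fun h => h.2⟩
  rw [sum_congr rfl h1, sum_congr rfl h2, sum_add_distrib, sum_const, smul_eq_mul]
  congr 1
  exact sum_card_bipartiteAbove_eq_sum_card_bipartiteBelow _

lemma SupportedOn.degree_lt {U : Finset V} (hG : SupportedOn G U) {v : V} (hv : v ∈ U) :
    G.degree v < #U := by
  rw [← G.card_neighborFinset_eq_degree]
  refine card_lt_card ((ssubset_iff_of_subset fun b hb => ?_).2 ⟨v, hv, by simp⟩)
  exact hG b v (by simpa using SimpleGraph.Adj.symm ((G.mem_neighborFinset _ _).1 hb))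

/-- A graph with an isolated vertex in `U` that no move improves is close to a complete graph: it has
a clique `W` that meets all edges, whose degrees are between `q` and `D`, where
`#W ≤ q ≤ D < 3 * #W`. -/
lemma exists_clique_of_stuck {U : Finset V} {j ε : ℕ} (hε : ε = 0 ∨ ε = 1 ∧ j = 1)
    (hG : SupportedOn G U) (hstuck : ∀ G', ¬ Improves U (j + 2) ε G G') {z : V} (hzU : z ∈ U)
    (hz : G.degree z = 0) (hU : 2 ≤ #U) (hm : 2 * (#U - 1) ≤ degreeSum G) :
    ∃ (W : Finset V) (q D : ℕ), (∀ w ∈ W, q ≤ G.degree w) ∧ (∀ v, G.degree v ≤ D) ∧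
      (∀ v ∉ W, G.degree v ≤ #W) ∧ #W ≤ q ∧ q + 3 ≤ 2 * #W ∧ D + 3 ≤ q + #W ∧ D < #U ∧
      ∑ v ∈ Wᶜ, G.degree v + #W * (#W - 1) = ∑ w ∈ W, G.degree w := by
  have hpos : ∀ {a b}, G.Adj a b → 0 < G.degree a := fun {a b} h =>
    (G.degree_pos_iff_exists_adj a).2 ⟨b, h⟩
  -- neighbourhoods are nested along the order of degrees
  have shift : ∀ {u v w}, v ∈ U → G.degree u ≤ G.degree v → G.Adj u w → v ≠ w → G.Adj v w := by
    intro u v w hv huv huw hne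
    by_contra hvw
    obtain ⟨G', hG'⟩ := exists_improves_of_shift hε hG hv huv huw hvw hne
    exact hstuck G' hG'
  -- an edge exists, so some vertex has a neighbour of at most its own degree
  obtain ⟨a, b, hab⟩ : ∃ a b, G.Adj a b := by
    by_contra! h
    have : degreeSum G = 0 := sum_eq_zero fun v _ => by
      by_contra hv
      obtain ⟨b, hb⟩ := (G.degree_pos_iff_exists_adj v).1 (Nat.pos_of_ne_zero hv)
      exact h v b hb
    omega
  have hCne : (univ.filter fun c => ∃ y, G.Adj c y ∧ G.degree y ≤ G.degree c).Nonempty := by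
    rcases le_total (G.degree a) (G.degree b) with h | h
    · exact ⟨b, by simpa using ⟨a, hab.symm, h⟩⟩
    · exact ⟨a, by simpa using ⟨b, hab, h⟩⟩
  -- `c` is the centre of least degree, `y` its neighbour of least degree; `N(y)` will be the clique
  obtain ⟨c, hc, hcmin'⟩ := exists_min_image _ (fun v => G.degree v) hCne
  simp only [mem_filter, mem_univ, true_and] at hc hcmin'
  have hcmin : ∀ {u w}, G.Adj u w → G.degree w ≤ G.degree u → G.degree c ≤ G.degree u :=
    fun {u w} h1 h2 => hcmin' u ⟨w, h1, h2⟩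
  obtain ⟨y₀, hy₀, hy₀c⟩ := hc
  obtain ⟨y, hy, hymin⟩ := exists_min_image (G.neighborFinset c) (fun v => G.degree v)
    ⟨y₀, by simpa using hy₀⟩
  simp only [SimpleGraph.mem_neighborFinset] at hy hymin
  have hyc : G.degree y ≤ G.degree c := (hymin y₀ hy₀).trans hy₀c
  set W := G.neighborFinset y with hW
  have hWcard : #W = G.degree y := G.card_neighborFinset_eq_degree y
  have memW : ∀ {w}, w ∈ W ↔ G.Adj y w := by simp [hW]
  have hcW : c ∈ W := memW.2 hy.symm
  have inU : ∀ {a b}, G.Adj a b → a ∈ U := fun {a b} h => hG a b h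
  have hWdeg : ∀ w ∈ W, G.degree c ≤ G.degree w := by
    intro w hw
    rw [memW] at hw
    by_contra! hlt
    have hcw : G.Adj c w := shift (inU hy) hyc hw (by rintro rfl; exact lt_irrefl _ hlt)
    exact hlt.not_ge (hcmin hw.symm (hymin w hcw))
  have hclique : ∀ a ∈ W, ∀ b ∈ W, a ≠ b → G.Adj a b := fun a ha b hb hne =>
    shift (inU (memW.1 ha).symm) (hyc.trans (hWdeg a ha)) (memW.1 hb) hne
  have hlarge : ∀ {u w}, G.Adj u w → G.degree w ≤ G.degree u → u ∉ W → w ∈ W := by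
    intro u w huw hle hu
    by_cases huy : u = y
    · subst huy
      exact memW.2 huw
    · exact absurd (memW.2 (shift (inU huw) (hcmin huw hle) hy huy).symm) hu
  have hcover : ∀ a b, G.Adj a b → a ∉ W → b ∈ W := by
    intro a b hab ha
    rcases le_total (G.degree b) (G.degree a) with h | h
    · exact hlarge hab h ha
    · by_contra hb
      exact ha (hlarge hab.symm h hb)
  have hsum := degreeSum_add_of_clique_cover hclique hcover
  have hout : ∀ v ∉ W, G.degree v ≤ #W := by
    intro v hv
    rw [← G.card_neighborFinset_eq_degree]
    exact card_le_card fun b hb => hcover v b (by simpa using hb) hv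
  have hypos : 0 < G.degree y := hpos hy.symm
  -- otherwise `G` would be a star that misses `z`
  have hK2 : 2 ≤ #W := by
    by_contra! hlt
    have h1 : #W = 1 := by omega
    obtain ⟨c', hc'⟩ := card_eq_one.1 h1
    have hWc : W = {c} := by
      rw [hc'] at hcW ⊢
      rw [mem_singleton.1 hcW]
    have h2 : degreeSum G = ∑ v ∈ W, G.degree v + ∑ v ∈ Wᶜ, G.degree v :=
      (sum_add_sum_compl W _).symm
    have h3 : G.degree c ≤ #U - 2 := by
      have hzc : z ≠ c := by rintro rfl; omega
      rw [← G.card_neighborFinset_eq_degree]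
      have : #((U.erase c).erase z) = #U - 2 := by
        rw [card_erase_of_mem (mem_erase.2 ⟨hzc, hzU⟩), card_erase_of_mem (inU hy)]
        omega
      rw [← this]
      refine card_le_card fun b hb => ?_
      rw [SimpleGraph.mem_neighborFinset] at hb
      refine mem_erase.2 ⟨?_, mem_erase.2 ⟨hb.ne', inU hb.symm⟩⟩
      rintro rfl
      have := hpos hb.symm
      omega
    rw [h1] at hsum
    rw [← hsum] at h2
    simp only [hWc, sum_singleton] at hsum h2
    omega
  have hleaf : ∀ u, G.Adj c u → u ∉ W → G.degree u = #W := by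
    intro u hcu hu
    refine le_antisymm (hout u hu) ?_
    rw [hWcard]
    exact hymin u hcu
  -- otherwise `c` has enough neighbours outside `W` for a relocation
  have hq : G.degree c + 3 ≤ 2 * #W := by
    by_contra! hlt
    have hYcard : #(W.erase c) ≤ #(G.neighborFinset c \ W) := by
      have h1 : #(G.neighborFinset c ∩ W) ≤ #(W.erase c) := by
        refine card_le_card fun b hb => ?_
        rw [mem_inter, SimpleGraph.mem_neighborFinset] at hb
        exact mem_erase.2 ⟨hb.1.ne', hb.2⟩
      have h2 := card_sdiff_add_card_inter (G.neighborFinset c) W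
      rw [G.card_neighborFinset_eq_degree] at h2
      rw [card_erase_of_mem hcW] at h1 ⊢
      omega
    obtain ⟨Y, hYsub, hYc⟩ := exists_subset_card_eq hYcard
    have hY : ∀ w ∈ Y, G.Adj c w ∧ w ∉ W := fun w hw => by
      have := hYsub hw
      rwa [mem_sdiff, SimpleGraph.mem_neighborFinset] at this
    have he : #(W.erase c) = #W - 1 := card_erase_of_mem hcW
    obtain ⟨G', hG'⟩ := exists_improves_of_relocate (Y := Y) hε hG (c := c) (z := z)
      (A := W.erase c) (fun w hw => (hY w hw).1) (by simp)
      (disjoint_left.2 fun w hw hw' => (hY w hw').2 (mem_of_mem_erase hw))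
      (card_pos.1 (by omega)) hYc (fun w hw => by rw [hleaf w (hY w hw).1 (hY w hw).2]; omega)
      (fun w hw => hWdeg w (mem_of_mem_erase hw))
      (fun w hw => inU (memW.1 (mem_of_mem_erase hw)).symm) hzU hz (by omega)
    exact hstuck G' hG'
  obtain ⟨v₀, -, hv₀⟩ := exists_max_image univ (fun v => G.degree v) ⟨z, mem_univ z⟩
  -- a vertex of maximum degree other than `c` and `y`
  obtain ⟨v, hvW, hvc, hvmax⟩ : ∃ v ∈ W, v ≠ c ∧ ∀ u, G.degree u ≤ G.degree v := by
    rcases (hv₀ c (mem_univ c)).eq_or_lt with h | h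
    · obtain ⟨v, hv, hvc⟩ := exists_mem_ne (by omega : 1 < #W) c
      exact ⟨v, hv, hvc, fun u => (hv₀ u (mem_univ u)).trans (h ▸ hWdeg v hv)⟩
    · have hvc : v₀ ≠ c := by rintro rfl; exact lt_irrefl _ h
      have hvy : v₀ ≠ y := by rintro rfl; omega
      have hvU : v₀ ∈ U := by
        obtain ⟨b, hb⟩ := (G.degree_pos_iff_exists_adj v₀).1 (by omega)
        exact inU hb
      exact ⟨v₀, memW.2 (shift hvU h.le hy hvy).symm, hvc, fun u => hv₀ u (mem_univ u)⟩
  have hD : G.degree v + 3 ≤ G.degree c + #W := by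
    by_contra! hlt
    obtain ⟨G', hG'⟩ := exists_improves_of_edge hε hG hy (hclique v hvW c hcW hvc)
      (memW.1 hvW).symm hzU hz (by omega)
    exact hstuck G' hG'
  exact ⟨W, G.degree c, G.degree v, hWdeg, hvmax, hout, by omega, hq, hD,
    hG.degree_lt (inU (memW.1 hvW).symm), hsum⟩

end Stuck

/-! ### Counting stars in nearly complete graphs -/

section NearComplete
open Finset
open scoped Classical

variable {V : Type*} [Fintype V] {G : SimpleGraph V}

/-- The number of `k`-edge stars (plus `ε` times the number of triangles) of the initial segment of
the lexicographic order on the pairs from `h + r + s + 1` points which consists of all pairs that meet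
the first `h` points and of `r` further pairs at the next point. -/
def lexStars (k ε h r s : ℕ) : ℕ :=
  h * (h + r + s).choose k + (h + r).choose k + r * (h + 1).choose k + s * h.choose k +
    ε * (h.choose 3 + h.choose 2 * (r + s + 1) + h * r)

lemma two_mul_choose_two (d : ℕ) : 2 * d.choose 2 = d * (d - 1) := by
  rw [Nat.choose_two_right]
  exact Nat.mul_div_cancel' (Nat.even_mul_pred_self d).two_dvd

/-- `e.choose (j + 1) / e` is monotone in `e`. -/
lemma mul_choose_le {e N j : ℕ} (h : e ≤ N) :
    N * e.choose (j + 1) ≤ N.choose (j + 1) * e := by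
  rcases e with _ | e
  · simp
  obtain ⟨N, rfl⟩ : ∃ M, N = M + 1 := ⟨N - 1, by omega⟩
  have h1 := Nat.add_one_mul_choose_eq e j
  have h2 := Nat.add_one_mul_choose_eq N j
  have h3 : e.choose j ≤ N.choose j := Nat.choose_le_choose _ (by omega)
  refine Nat.le_of_mul_le_mul_right ?_ (Nat.succ_pos j)
  calc (N + 1) * (e + 1).choose (j + 1) * (j + 1)
      = (N + 1) * ((e + 1) * e.choose j) := by rw [h1]; ring
    _ ≤ (N + 1) * ((e + 1) * N.choose j) := by gcongr
    _ = (N + 1).choose (j + 1) * (e + 1) * (j + 1) := by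
        rw [mul_right_comm, ← h2]; ring

lemma choose_two_mul_choose (d i : ℕ) :
    (i + 2).choose 2 * d.choose (i + 2) = d.choose 2 * (d - 2).choose i := by
  rcases lt_or_ge d (i + 2) with h | h
  · rw [Nat.choose_eq_zero_of_lt h]
    rcases lt_or_ge d 2 with h2 | h2
    · simp [Nat.choose_eq_zero_of_lt h2]
    · simp [Nat.choose_eq_zero_of_lt (by omega : d - 2 < i)]
  · have := Nat.choose_mul (n := d) (k := i + 2) (s := 2) (by omega)
    rw [mul_comm, this, Nat.add_sub_cancel]

/-- A triangle is determined by one of its vertices and the cherry there. -/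
lemma card_triangles_le : #(G.cliqueFinset 3) ≤ numStars 2 0 G := by
  have hsub : G.cliqueFinset 3 ⊆
      univ.biUnion fun v => ((G.neighborFinset v).powersetCard 2).image (insert v) := by
    intro s hs
    rw [SimpleGraph.mem_cliqueFinset_iff, SimpleGraph.is3Clique_iff] at hs
    obtain ⟨a, b, c, hab, hac, hbc, rfl⟩ := hs
    simp only [mem_biUnion, mem_univ, true_and, mem_image, mem_powersetCard]
    refine ⟨a, {b, c}, ⟨?_, card_pair hbc.ne⟩, rfl⟩
    intro w hw
    simp only [mem_insert, mem_singleton] at hw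
    rcases hw with rfl | rfl <;> simpa
  refine (card_le_card hsub).trans (card_biUnion_le.trans ?_)
  simp only [numStars, zero_mul, add_zero]
  refine sum_le_sum fun v _ => card_image_le.trans ?_
  simp

/-- If the maximum degree is small, the number of larger stars is controlled by the number of
cherries. -/
lemma numStars_le_of_cherries {j ε D N h : ℕ} (hε : ε = 0 ∨ ε = 1 ∧ j = 0)
    (hD : ∀ v, G.degree v ≤ D) (hD2 : 2 ≤ D) (hDN : D ≤ N + 2) (hN : 0 < N)
    (hX : 2 * numStars 2 0 G * (D + 1) ≤ h * (N + 2) * (N + 1) * N) :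
    numStars (j + 3) ε G ≤ h * (N + 2).choose (j + 3) := by
  have hpos : 0 < N * (j + 3).choose 2 := Nat.mul_pos hN (Nat.choose_pos (by omega))
  refine Nat.le_of_mul_le_mul_left ?_ hpos
  have hS : numStars 2 0 G = ∑ v, (G.degree v).choose 2 := by simp [numStars]
  have h1 : N * (j + 3).choose 2 * ∑ v, (G.degree v).choose (j + 3) ≤
      N.choose (j + 1) * (numStars 2 0 G * (D - 2)) := by
    rw [hS, mul_sum, sum_mul, mul_sum]
    refine sum_le_sum fun v _ => ?_
    have h2 := choose_two_mul_choose (G.degree v) (j + 1)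
    have hv := hD v
    have h3 : N * (G.degree v - 2).choose (j + 1) ≤ N.choose (j + 1) * (D - 2) :=
      (mul_choose_le (by omega)).trans (Nat.mul_le_mul_left _ (by omega))
    calc N * (j + 3).choose 2 * (G.degree v).choose (j + 3)
        = (G.degree v).choose 2 * (N * (G.degree v - 2).choose (j + 1)) := by
          rw [mul_assoc, h2]; ring
      _ ≤ (G.degree v).choose 2 * (N.choose (j + 1) * (D - 2)) := Nat.mul_le_mul_left _ h3
      _ = _ := by ring
  have h2 : N * (j + 3).choose 2 * (ε * #(G.cliqueFinset 3)) ≤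
      N.choose (j + 1) * (numStars 2 0 G * 3) := by
    rcases hε with rfl | ⟨rfl, rfl⟩
    · simp
    · have := card_triangles_le (G := G)
      have e : (0 + 3).choose 2 = 3 := rfl
      rw [e, zero_add, Nat.choose_one_right]
      nlinarith [Nat.mul_le_mul_left (N * 3) this]
  have h3 : N * (j + 3).choose 2 * numStars (j + 3) ε G ≤
      N.choose (j + 1) * (numStars 2 0 G * (D + 1)) := by
    unfold numStars at h1 h2 ⊢
    have : D + 1 = (D - 2) + 3 := by omega
    rw [mul_add, this]
    linarith
  have h4 : numStars 2 0 G * (D + 1) ≤ h * (N + 2).choose 2 * N := by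
    have := two_mul_choose_two (N + 2)
    rw [show N + 2 - 1 = N + 1 by omega] at this
    have h5 : h * (N + 2) * (N + 1) * N = 2 * (h * (N + 2).choose 2 * N) := by
      rw [mul_assoc h, ← this]; ring
    linarith
  have h5 := choose_two_mul_choose (N + 2) (j + 1)
  rw [Nat.add_sub_cancel] at h5
  calc _ ≤ _ := h3
    _ ≤ N.choose (j + 1) * (h * (N + 2).choose 2 * N) := Nat.mul_le_mul_left _ h4
    _ = N * h * ((N + 2).choose 2 * N.choose (j + 1)) := by ring
    _ = N * h * ((j + 1 + 2).choose 2 * (N + 2).choose (j + 1 + 2)) := by rw [h5]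
    _ = _ := by ring

/-- The bound `X ≤ m (m / K + 2 K)` on `X = ∑ d (d - 1)`, twice the number of cherries, for a graph
with `m` edges and a clique of `K` vertices as in `exists_clique_of_stuck`; also the relations between
the degree sum and the degrees in the clique that bound `m` in terms of `K`. -/
lemma cherries_le_of_clique_cover {W : Finset V} {q D : ℕ} (hq : ∀ w ∈ W, q ≤ G.degree w)
    (hD : ∀ v, G.degree v ≤ D) (hout : ∀ v ∉ W, G.degree v ≤ #W) (hWq : #W ≤ q) (hK1 : 1 ≤ #W)
    (hDq : D + 3 ≤ q + #W)
    (hsum : ∑ v ∈ Wᶜ, G.degree v + #W * (#W - 1) = ∑ w ∈ W, G.degree w) :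
    4 * #W * (2 * numStars 2 0 G) ≤ degreeSum G * (degreeSum G + 4 * #W ^ 2) ∧
      degreeSum G + #W * (#W - 1) = 2 * ∑ w ∈ W, G.degree w ∧
      #W * q ≤ ∑ w ∈ W, G.degree w ∧ ∑ w ∈ W, G.degree w ≤ #W * D := by
  set K := #W with hK
  set A := ∑ w ∈ W, G.degree w with hA
  have h2 : degreeSum G = A + ∑ v ∈ Wᶜ, G.degree v := (sum_add_sum_compl W _).symm
  have hM : degreeSum G + K * (K - 1) = 2 * A := by omega
  have hAq : K * q ≤ A := by
    rw [← smul_eq_mul]; exact card_nsmul_le_sum _ _ _ hq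
  have hAD : A ≤ K * D := by
    rw [← smul_eq_mul]; exact sum_le_card_nsmul _ _ _ fun v _ => hD v
  refine ⟨?_, hM, hAq, hAD⟩
  have hX : (2 * numStars 2 0 G : ℤ) = ∑ v ∈ W, (G.degree v : ℤ) * (G.degree v - 1) +
      ∑ v ∈ Wᶜ, (G.degree v : ℤ) * (G.degree v - 1) := by
    rw [sum_add_sum_compl]
    simp only [numStars, zero_mul, add_zero]
    push_cast
    rw [mul_sum]
    refine sum_congr rfl fun v _ => ?_
    have := two_mul_choose_two (G.degree v)
    rcases Nat.eq_zero_or_pos (G.degree v) with h | h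
    · simp [h]
    · zify [h] at this
      exact this
  -- convexity of `d (d - 1)` on `[q, D]`
  have hX1 : ∑ v ∈ W, (G.degree v : ℤ) * (G.degree v - 1) ≤ (q + D - 1) * A - K * (q * D) := by
    have : ∑ v ∈ W, ((q + D - 1 : ℤ) * G.degree v - q * D) = (q + D - 1) * A - K * (q * D) := by
      rw [sum_sub_distrib, ← mul_sum, sum_const, hA]
      push_cast
      simp [hK]
    rw [← this]
    refine sum_le_sum fun v hv => ?_
    have h3 : (q : ℤ) ≤ G.degree v := by exact_mod_cast hq v hv
    have h4 : (G.degree v : ℤ) ≤ D := by exact_mod_cast hD v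
    nlinarith [mul_nonneg (sub_nonneg.2 h3) (sub_nonneg.2 h4)]
  have hX2 : ∑ v ∈ Wᶜ, (G.degree v : ℤ) * (G.degree v - 1) ≤ (K - 1) * (A - K * (K - 1)) := by
    have : (∑ v ∈ Wᶜ, (G.degree v : ℤ)) = A - K * (K - 1) := by
      have h5 : ((∑ v ∈ Wᶜ, G.degree v + K * (K - 1) : ℕ) : ℤ) = A := by exact_mod_cast hsum
      push_cast [hK1] at h5
      linarith
    rw [← this, mul_sum]
    refine sum_le_sum fun v hv => ?_
    have h3 : (G.degree v : ℤ) ≤ K := by exact_mod_cast hout v (mem_compl.1 hv)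
    have h4 : (0 : ℤ) ≤ G.degree v := by positivity
    nlinarith
  have hM' : (degreeSum G : ℤ) = 2 * A - K * (K - 1) := by
    have h5 : ((degreeSum G + K * (K - 1) : ℕ) : ℤ) = (2 * A : ℕ) := by exact_mod_cast hM
    push_cast [hK1] at h5
    linarith
  zify
  rw [hX, hM']
  have hAq' : (K * q : ℤ) ≤ A := by exact_mod_cast hAq
  have hWq' : (K : ℤ) ≤ q := by exact_mod_cast hWq
  have hDq' : (D + 3 : ℤ) ≤ q + K := by exact_mod_cast hDq
  have hK0 : (0 : ℤ) ≤ K := by positivity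
  generalize (A : ℤ) = a at *
  generalize (K : ℤ) = κ at *
  generalize (q : ℤ) = p at *
  generalize (D : ℤ) = d at *
  -- the bound increases with `d`, so `d` may be replaced by `p + κ - 3`
  have h6 : (p + d - 1) * a - κ * (p * d) ≤ (2 * p + κ - 4) * a - κ * (p * (p + κ - 3)) := by
    nlinarith [mul_nonneg (sub_nonneg.2 hAq') (sub_nonneg.2 hDq')]
  have h7 : (2 * a - κ * (κ - 1)) * (2 * a - κ * (κ - 1) + 4 * κ ^ 2) -
      4 * κ * ((2 * p + κ - 4) * a - κ * (p * (p + κ - 3)) + (κ - 1) * (a - κ * (κ - 1))) =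
      (2 * a - κ * (κ - 1) - 2 * κ * p) ^ 2 +
        4 * (3 * κ ^ 2 * p + 5 * κ * (a - κ * p) - κ ^ 2 * (κ - 1)) := by
    ring
  have h8 : 0 ≤ 3 * κ ^ 2 * p + 5 * κ * (a - κ * p) - κ ^ 2 * (κ - 1) := by
    have h9 : 0 ≤ κ * (a - κ * p) := mul_nonneg hK0 (by linarith)
    have h10 : κ ^ 2 * κ ≤ κ ^ 2 * p := mul_le_mul_of_nonneg_left hWq' (by positivity)
    have h11 : 0 ≤ κ ^ 2 * κ := mul_nonneg (sq_nonneg κ) hK0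
    linarith [sq_nonneg κ]
  have h9 : 4 * κ * (∑ v ∈ W, (G.degree v : ℤ) * (G.degree v - 1) +
      ∑ v ∈ Wᶜ, (G.degree v : ℤ) * (G.degree v - 1)) ≤ 4 * κ * ((2 * p + κ - 4) * a -
        κ * (p * (p + κ - 3)) + (κ - 1) * (a - κ * (κ - 1))) :=
    mul_le_mul_of_nonneg_left (by linarith) (by positivity)
  linarith [sq_nonneg (2 * a - κ * (κ - 1) - 2 * κ * p)]

end NearComplete

/-! ### The extremal theorem for star counts -/

section Main
open Finset
open scoped Classical

/-- The bound of `cherries_le_of_clique_cover`, for a graph with degree sum `M` and a clique of `K`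
vertices, is at most twice the number of cherries of the lexicographic graph: both compare with
`M ^ 2 / (4 * (h + 1))`. -/
lemma cherries_numerics {h r s M K X : ℕ} (hh : 1 ≤ h) (hr : 1 ≤ r)
    (hn : 32 * (h + 1) ≤ h + r + s + 1)
    (hM : M + h * (h + 1) = 2 * h * (h + r + s + 1) + 2 * r) (hM5 : M ≤ 5 * K ^ 2)
    (hMK : K ^ 2 ≤ M) (hX : 4 * K * X ≤ M * (M + 4 * K ^ 2)) :
    X ≤ h * ((h + r + s) * (h + r + s - 1)) + (h + r) * (h + r - 1) + r * ((h + 1) * h) +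
      s * (h * (h - 1)) := by
  have hK0 : 0 < K := by
    rcases Nat.eq_zero_or_pos K with rfl | h0
    · nlinarith
    · exact h0
  have hh' : (1 : ℤ) ≤ h := by exact_mod_cast hh
  have hs : (0 : ℤ) ≤ s := by positivity
  zify [show 1 ≤ h + r + s by omega, show 1 ≤ h + r by omega, hh] at *
  generalize (h : ℤ) = h at *
  generalize hH : h + 1 = H at *
  obtain rfl : h = H - 1 := by linarith
  generalize (r : ℤ) = r at *
  generalize (s : ℤ) = s at *
  generalize (M : ℤ) = M at *
  generalize (K : ℤ) = K at *
  generalize (X : ℤ) = X at *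
  have h1 : 31 * H ^ 2 ≤ M := by
    have : 0 ≤ (H - 1) * (H - 1 + r + s + 1 - 32 * H) := mul_nonneg (by linarith) (by linarith)
    nlinarith
  have h2K : 2 * H ≤ K := by nlinarith
  -- with `31 * H ^ 2 ≤ M ≤ 5 * K ^ 2` this is quadratic in `K` below `5 * H`
  have h2 : H * (M + 4 * K ^ 2) ≤ M * K := by
    rcases le_total (5 * H) K with h5 | h5
    · have h6 : M * (4 * H) ≤ M * (K - H) := mul_le_mul_of_nonneg_left (by linarith) (by nlinarith)
      have h7 : 4 * H * K ^ 2 ≤ 4 * H * M := mul_le_mul_of_nonneg_left hMK (by linarith)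
      linarith
    · have h6 : 31 * H ^ 2 * (K - H) ≤ M * (K - H) :=
        mul_le_mul_of_nonneg_right h1 (by linarith)
      have h7 : 0 ≤ (K - 2 * H) * (5 * H - K) := mul_nonneg (by linarith) (by linarith)
      have h8 : 0 ≤ H * K := mul_nonneg (by linarith) (by linarith)
      have h9 : 0 ≤ H * (31 * H * K - 31 * H ^ 2 - 4 * K ^ 2) :=
        mul_nonneg (by linarith) (by nlinarith)
      nlinarith
  have hM0 : 0 ≤ M := by nlinarith
  have h3 : 4 * H * X ≤ M ^ 2 := by
    refine le_of_mul_le_mul_left ?_ hK0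
    nlinarith [mul_le_mul_of_nonneg_left h2 hM0,
      mul_le_mul_of_nonneg_left hX (by linarith : 0 ≤ H)]
  -- by convexity, since the first `H` vertices of the lexicographic graph cover all its edges
  have h4 : M ^ 2 ≤ 4 * H * ((H - 1) * ((H - 1 + r + s) * (H - 1 + r + s - 1)) +
      (H - 1 + r) * (H - 1 + r - 1) + r * (H * (H - 1)) + s * ((H - 1) * (H - 1 - 1))) := by
    have e : M = 2 * ((H - 1) * (H - 1 + r + s) + (H - 1 + r)) - (H - 1) * H := by linarith
    have hH2 : 2 ≤ H := by linarith
    have h5 : 0 ≤ (H - 1 + r + s - H) * (H - 2) := mul_nonneg (by linarith) (by linarith)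
    have h6 : 0 ≤ H * (r - 1) := mul_nonneg (by linarith) (by linarith)
    have h7 : (H - 1) * H ≤ 4 * ((H - 1 + r + s) * (H - 2) + r * H) := by nlinarith
    have h8 := mul_le_mul_of_nonneg_left h7
      (mul_nonneg (by linarith) (by linarith) : 0 ≤ H * (H - 1))
    have h9 : 0 ≤ H * ((H - 1 + r) * (H - 2)) :=
      mul_nonneg (by linarith) (mul_nonneg (by linarith) (by linarith))
    have h10 : 0 ≤ H * (s * ((H - 1) * (H - 2))) :=
      mul_nonneg (by linarith) (mul_nonneg hs (mul_nonneg (by linarith) (by linarith)))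
    have h11 : 0 ≤ (H - 1) * s ^ 2 := mul_nonneg (by linarith) (sq_nonneg s)
    rw [e]
    linarith
  exact le_of_mul_le_mul_left (h3.trans h4) (by linarith)

/-- For stars with more than two edges it is enough to compare with the `h` vertices of full degree
`N + 2` of the lexicographic graph. -/
lemma larger_stars_numerics {h r s M K X N D : ℕ} (hh : 1 ≤ h)
    (hn : 32 * (h + 1) ≤ h + r + s + 1) (hN : N + 3 = h + r + s + 1)
    (hM : M + h * (h + 1) = 2 * h * (h + r + s + 1) + 2 * r)
    (hMK : K ^ 2 ≤ M) (hX : 4 * K * X ≤ M * (M + 4 * K ^ 2)) (hK : 0 < K) (hD : D + 1 ≤ 3 * K) :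
    X * (D + 1) ≤ h * (N + 2) * (N + 1) * N := by
  have h1 : 4 * (X * (D + 1)) ≤ 15 * M ^ 2 := by
    refine Nat.le_of_mul_le_mul_left ?_ hK
    calc K * (4 * (X * (D + 1))) = (4 * K * X) * (D + 1) := by ring
      _ ≤ (M * (M + 4 * K ^ 2)) * (3 * K) := Nat.mul_le_mul hX hD
      _ ≤ (M * (M + 4 * M)) * (3 * K) := by gcongr
      _ = K * (15 * M ^ 2) := by ring
  have h2 : M ≤ 2 * (h + 1) * (N + 2) := by nlinarith
  have h3 : 30 * (h + 1) ^ 2 * (N + 2) ≤ 2 * h * ((N + 1) * N) := by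
    have h4 : 32 * (30 * (h + 1) ^ 2 * (N + 2)) ≤ 60 * h * ((N + 3) * (N + 2)) := by
      calc 32 * (30 * (h + 1) ^ 2 * (N + 2)) = 30 * (h + 1) * ((32 * (h + 1)) * (N + 2)) := by ring
        _ ≤ 30 * (2 * h) * ((N + 3) * (N + 2)) := by gcongr <;> omega
        _ = _ := by ring
    have h5 : 60 * ((N + 3) * (N + 2)) ≤ 64 * ((N + 1) * N) := by
      have : 61 ≤ N := by omega
      nlinarith
    have h6 := Nat.mul_le_mul_left h h5
    linarith
  have h7 : M ^ 2 ≤ (2 * (h + 1) * (N + 2)) ^ 2 := Nat.pow_le_pow_left h2 2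
  have h8 := Nat.mul_le_mul_left (2 * (N + 2)) h3
  nlinarith

variable {V : Type*} [Fintype V] {G : SimpleGraph V}

lemma exists_adj_of_degreeSum_pos (h : 0 < degreeSum G) : ∃ a b, G.Adj a b := by
  by_contra! h'
  refine h.ne' (sum_eq_zero fun v _ => ?_)
  by_contra hv
  obtain ⟨b, hb⟩ := (G.degree_pos_iff_exists_adj v).1 (Nat.pos_of_ne_zero hv)
  exact h' v b hb

/-- No edge is at both of two nonadjacent vertices. -/
lemma two_mul_degree_add_degree_le {x y : V} (hxy : x ≠ y) (hadj : ¬ G.Adj x y) :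
    2 * (G.degree x + G.degree y) ≤ degreeSum G := by
  have h1 := degreeSum_delStar (G := G) (x := x) (Y := G.neighborFinset x) (by simp)
  have h2 := degreeSum_delStar (G := delStar G x (G.neighborFinset x)) (x := y)
    (Y := (delStar G x (G.neighborFinset x)).neighborFinset y) (by simp)
  rw [SimpleGraph.card_neighborFinset_eq_degree] at h1 h2
  rw [degree_delStar_other (by simp) hxy.symm (by simpa using hadj)] at h2
  omega

/-- A graph with `m` edges has at most `m.choose k` intersecting sets of `k` edges. -/
lemma numStars_le_choose {j ε : ℕ} (hε : ε = 0 ∨ ε = 1 ∧ j = 1) (m : ℕ) :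
    ∀ G : SimpleGraph V, degreeSum G = 2 * m → numStars (j + 2) ε G ≤ m.choose (j + 2) := by
  induction m with
  | zero =>
    intro G hG
    have h0 : ∀ v, G.degree v = 0 := by
      simpa [degreeSum] using hG
    have h2 : ∀ i, numStars (i + 2) 0 G = 0 := fun i => by simp [numStars, h0]
    have h3 := (card_triangles_le (G := G)).trans_eq (h2 0)
    have h4 := h2 j
    simp only [numStars, zero_mul, add_zero] at h4 ⊢
    rw [h4, Nat.le_zero.1 h3]
    simp
  | succ m ih =>
    intro G hG
    obtain ⟨x, y, hxy, hle⟩ : ∃ x y, G.Adj x y ∧ G.degree y ≤ G.degree x := by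
      obtain ⟨a, b, hab⟩ := exists_adj_of_degreeSum_pos (G := G) (by omega)
      rcases le_total (G.degree b) (G.degree a) with h | h
      · exact ⟨a, b, hab, h⟩
      · exact ⟨b, a, hab.symm, h⟩
    have hst : ∀ w ∈ ({y} : Finset V), G.Adj x w := by simpa using hxy
    set G₀ := delStar G x {y} with hG₀
    have hG₀y : ¬ G₀.Adj x y := not_adj_delStar (by simp)
    have hdy : G₀.degree y + 1 = G.degree y := degree_delStar_leaf hst (by simp)
    have hdx : G₀.degree x + 1 = G.degree x := by simpa using degree_delStar_center hst
    have hsum : degreeSum G₀ + 2 = degreeSum G := by simpa using degreeSum_delStar hst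
    have h1 := numStars_addEdge_le (G := G₀) hxy.ne hG₀y (j + 1) ε
    rw [addStar_delStar hst] at h1
    have h2 := ih G₀ (by omega)
    have h3 := two_mul_degree_add_degree_le hxy.ne hG₀y
    have h4 : (G₀.degree x).choose (j + 1) + (G₀.degree y).choose (j + 1) + ε * G₀.degree y ≤
        m.choose (j + 1) := by
      rcases Nat.eq_zero_or_pos (G₀.degree x) with h0 | h0
      · have h0' : G₀.degree y = 0 := by omega
        simp [h0, h0']
      · exact (choose_add_choose_add_le h0 hε).trans (Nat.choose_le_choose _ (by omega))
    have h5 := Nat.choose_succ_succ m (j + 1)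
    simp only [Nat.succ_eq_add_one] at h5
    linarith

/-- The value of the lexicographic graph satisfies the recursion of `numStars_cone`. -/
lemma lexStars_succ (j ε h r s : ℕ) :
    2 * lexStars (j + 2) ε (h + 1) r s = 2 * (h + 1 + r + s).choose (j + 2) +
      2 * lexStars (j + 2) ε h r s + 2 * lexStars (j + 1) 0 h r s + ε * lexStars 1 0 h r s := by
  have e : h + 1 + r + s = (h + r + s) + 1 := by ring
  have e' : h + 1 + r = (h + r) + 1 := by ring
  have h2 : 2 * h.choose 2 + h = h * h := by
    rw [two_mul_choose_two]
    rcases h with _ | h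
    · simp
    · simp; ring
  have h3 : 2 * ((h + 1).choose 3 + (h + 1).choose 2 * (r + s + 1) + (h + 1) * r) =
      2 * (h.choose 3 + h.choose 2 * (r + s + 1) + h * r) + lexStars 1 0 h r s := by
    have c3 : (h + 1).choose 3 = h.choose 2 + h.choose 3 := rfl
    have c2 : (h + 1).choose 2 = h + h.choose 2 := by
      rw [Nat.choose_succ_succ' h 1, Nat.choose_one_right]
    simp only [lexStars, c3, c2, Nat.choose_one_right, zero_mul, add_zero]
    linarith
  have h4 := congrArg (ε * ·) h3
  have c1 : (h + 1 + r + s).choose (j + 2) =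
      (h + r + s).choose (j + 1) + (h + r + s).choose (j + 2) := by rw [e]; rfl
  have c2 : (h + 1 + r).choose (j + 2) = (h + r).choose (j + 1) + (h + r).choose (j + 2) := by
    rw [e']; rfl
  have c3 : (h + 1 + 1).choose (j + 2) = (h + 1).choose (j + 1) + (h + 1).choose (j + 2) := rfl
  have c4 : (h + 1).choose (j + 2) = h.choose (j + 1) + h.choose (j + 2) := rfl
  simp only [lexStars, c1, c2, c3, c4, zero_mul, add_zero] at h4 ⊢
  linarith

lemma lexStars_one (h r s : ℕ) :
    lexStars 1 0 h r s + h * (h + 1) = 2 * h * (h + r + s + 1) + 2 * r := by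
  simp [lexStars]
  ring

/-- Adding a dominating vertex: the star counts are governed by Pascal's rule. -/
lemma numStars_cone {x : V} {Y : Finset V} (hx : x ∉ Y) (hG : SupportedOn G Y) (k ε : ℕ) :
    2 * numStars (k + 2) ε (addStar G x Y) = 2 * (#Y).choose (k + 2) + 2 * numStars (k + 2) ε G +
      2 * numStars (k + 1) 0 G + ε * degreeSum G := by
  have hGx : ∀ a, ¬ G.Adj x a := fun a h => hx (hG _ _ h)
  have h1 := sum_choose_addStar (G := G) hx (fun y _ => hGx y) (k + 1)
  have h2 := card_triangles_cone hx hG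
  have h3 : G.degree x = 0 := by
    by_contra h0
    obtain ⟨b, hb⟩ := (G.degree_pos_iff_exists_adj x).1 (Nat.pos_of_ne_zero h0)
    exact hGx b hb
  have h4 : ∑ y ∈ Y, (G.degree y).choose (k + 1) = numStars (k + 1) 0 G := by
    simp only [numStars, zero_mul, add_zero]
    refine sum_subset (subset_univ _) fun v _ hv => ?_
    have : G.degree v = 0 := by
      by_contra h0
      obtain ⟨b, hb⟩ := (G.degree_pos_iff_exists_adj v).1 (Nat.pos_of_ne_zero h0)
      exact hv (hG _ _ hb)
    simp [this]
  rw [h3, h4] at h1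
  rw [Nat.choose_zero_succ, zero_add] at h1
  have h5 := congrArg (ε * ·) h2
  simp only [numStars, zero_mul, add_zero] at h1 ⊢
  linarith

lemma two_mul_lexStars_two (h r s : ℕ) : 2 * lexStars 2 0 h r s =
    h * ((h + r + s) * (h + r + s - 1)) + (h + r) * (h + r - 1) + r * ((h + 1) * h) +
      s * (h * (h - 1)) := by
  have h1 := two_mul_choose_two (h + r + s)
  have h2 := two_mul_choose_two (h + r)
  have h3 := two_mul_choose_two (h + 1)
  have h4 := two_mul_choose_two h
  rw [Nat.add_sub_cancel] at h3
  rw [← h1, ← h2, ← h3, ← h4]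
  simp only [lexStars]
  ring

/-- Every graph is dominated by one that no move improves. -/
lemma exists_stuck {U : Finset V} {j ε : ℕ} (hG : SupportedOn G U) :
    ∃ G', SupportedOn G' U ∧ degreeSum G' = degreeSum G ∧
      numStars (j + 2) ε G ≤ numStars (j + 2) ε G' ∧ ∀ G'', ¬ Improves U (j + 2) ε G' G'' := by
  obtain ⟨G', ⟨h1, h2, h3⟩, hmax⟩ := Set.exists_max_image
    {G' : SimpleGraph V | SupportedOn G' U ∧ degreeSum G' = degreeSum G ∧
      numStars (j + 2) ε G ≤ numStars (j + 2) ε G'}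
    -- lexicographic maximum: cherries first, then nonisolated vertices
    (fun G' => numStars 2 0 G' * (Fintype.card V + 1) + #(nonisolated G')) (Set.toFinite _)
    ⟨G, hG, rfl, le_rfl⟩
  refine ⟨G', h1, h2, h3, fun G'' h => ?_⟩
  have h4 := hmax G'' ⟨h.supportedOn, h.degreeSum_eq.trans h2, h3.trans h.numStars_le⟩
  have h5 : #(nonisolated G') ≤ Fintype.card V := card_le_univ _
  have h6 := h.cherries_le
  rcases h.lt with h7 | h7
  · nlinarith [Nat.mul_le_mul_right (Fintype.card V + 1) h7]
  · nlinarith [Nat.mul_le_mul_right (Fintype.card V + 1) h6]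

/-- If no vertex is joined to all of `U`, a vertex that a vertex of maximum degree misses is isolated:
otherwise an edge there could be shifted. -/
lemma exists_isolated_of_stuck {U : Finset V} {j ε : ℕ} (hε : ε = 0 ∨ ε = 1 ∧ j = 1)
    (hG : SupportedOn G U) (hstuck : ∀ G', ¬ Improves U (j + 2) ε G G') (hU : U.Nonempty)
    (hdom : ∀ v ∈ U, G.degree v + 1 ≠ #U) : ∃ z ∈ U, G.degree z = 0 := by
  obtain ⟨v, hvU, hv⟩ := exists_max_image U (fun v => G.degree v) hU
  obtain ⟨z, hz, hzv⟩ : ∃ z ∈ U.erase v, ¬ G.Adj v z := by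
    by_contra! h
    have h1 : #(U.erase v) ≤ G.degree v := by
      rw [← G.card_neighborFinset_eq_degree]
      exact card_le_card fun b hb => by simpa using h b hb
    rw [card_erase_of_mem hvU] at h1
    have := hG.degree_lt hvU
    exact hdom v hvU (by omega)
  rw [mem_erase] at hz
  refine ⟨z, hz.2, ?_⟩
  by_contra h0
  obtain ⟨w, hw⟩ := (G.degree_pos_iff_exists_adj z).1 (Nat.pos_of_ne_zero h0)
  obtain ⟨G', hG'⟩ := exists_improves_of_shift hε hG hvU (hv w (hG _ _ hw.symm)) hw.symm hzv
    hz.1.symm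
  exact hstuck G' hG'

/-- Among the graphs with `m` edges, the initial segments of the lexicographic order have the most
stars (and triangles) of any given size, as long as `m` is small compared to the square of the number
of vertices. -/
theorem numStars_le_lexStars (h : ℕ) : ∀ {r s j ε : ℕ} (_ : ε = 0 ∨ ε = 1 ∧ j = 1)
    (_ : h = 0 ∨ 1 ≤ r ∧ 32 * (h + 1) ≤ h + r + s + 1) (U : Finset V) (G : SimpleGraph V),
    #U = h + r + s + 1 → SupportedOn G U →
    degreeSum G + h * (h + 1) = 2 * h * (h + r + s + 1) + 2 * r →
    numStars (j + 2) ε G ≤ lexStars (j + 2) ε h r s := by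
  induction h with
  | zero =>
    intro r s j ε hε _ U G _ _ hsum
    have := numStars_le_choose hε r G (by omega)
    simpa [lexStars, Nat.choose_eq_zero_of_lt (by omega : 1 < j + 2)] using this
  | succ h ih =>
    intro r s j ε hε hn U G₁ hU hG₁ hsum₁
    obtain ⟨hr, hn⟩ := hn.resolve_left (by omega)
    obtain ⟨G, hG, hsum, hle, hstuck⟩ := exists_stuck (j := j) (ε := ε) hG₁
    refine hle.trans ?_
    rw [← hsum] at hsum₁
    by_cases hdom : ∃ v ∈ U, G.degree v + 1 = #U
    · obtain ⟨v, hvU, hv⟩ := hdom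
      have hY : ∀ w ∈ G.neighborFinset v, G.Adj v w := by simp
      have hvY : v ∉ G.neighborFinset v := by simp
      have hYcard : #(G.neighborFinset v) = h + r + s + 1 := by
        rw [G.card_neighborFinset_eq_degree]; omega
      have hYU : G.neighborFinset v = U.erase v := by
        refine eq_of_subset_of_card_le (fun b hb => ?_) ?_
        · rw [SimpleGraph.mem_neighborFinset] at hb
          exact mem_erase.2 ⟨hb.ne', hG _ _ hb.symm⟩
        · rw [card_erase_of_mem hvU]; omega
      set G₀ := delStar G v (G.neighborFinset v) with hG₀
      have hG₀Y : SupportedOn G₀ (G.neighborFinset v) := by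
        intro a b hab
        rw [hYU]
        refine mem_erase.2 ⟨?_, hG _ _ hab.1⟩
        rintro rfl
        exact hab.2.1 ⟨rfl, by simpa using hab.1⟩
      have hsum₀ : degreeSum G₀ + 2 * #(G.neighborFinset v) = degreeSum G := degreeSum_delStar hY
      have hsum' : degreeSum G₀ + h * (h + 1) = 2 * h * (h + r + s + 1) + 2 * r := by
        rw [hYcard] at hsum₀
        nlinarith
      have hcone := numStars_cone hvY hG₀Y j ε
      rw [addStar_delStar hY] at hcone
      have hsucc := lexStars_succ j ε h r s
      have hn' : h = 0 ∨ 1 ≤ r ∧ 32 * (h + 1) ≤ h + r + s + 1 := Or.inr ⟨hr, by omega⟩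
      have h1 := ih hε hn' _ G₀ hYcard hG₀Y hsum'
      have h2 : degreeSum G₀ = lexStars 1 0 h r s := by
        have := lexStars_one h r s
        omega
      have h3 : numStars (j + 1) 0 G₀ ≤ lexStars (j + 1) 0 h r s := by
        rcases j with _ | j
        · rw [← h2]
          simp [numStars, degreeSum]
        · exact ih (Or.inl rfl) hn' _ G₀ hYcard hG₀Y hsum'
      rw [h2, hYcard, show h + r + s + 1 = h + 1 + r + s by ring] at hcone
      linarith
    · push Not at hdom
      obtain ⟨z, hzU, hz⟩ := exists_isolated_of_stuck hε hG hstuck (card_pos.1 (by omega)) hdom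
      have hm : 2 * (#U - 1) ≤ degreeSum G := by
        rw [hU, Nat.add_sub_cancel]
        nlinarith
      obtain ⟨W, q, D, hq, hD, hout, hWq, hqW, hDq, hDU, hWsum⟩ :=
        exists_clique_of_stuck hε hG hstuck hzU hz (by omega) hm
      obtain ⟨hX, hM, hAq, hAD⟩ :=
        cherries_le_of_clique_cover hq hD hout hWq (by omega) hDq hWsum
      obtain ⟨w, hw⟩ := card_pos.1 (by omega : 0 < #W)
      have hqD : q ≤ D := (hq w hw).trans (hD w)
      generalize #W = K at *
      have hKK : K * (K - 1) + K = K ^ 2 := by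
        rw [show K * (K - 1) + K = K * (K - 1 + 1) by ring, Nat.sub_add_cancel (by omega)]
        ring
      have hMK : K ^ 2 ≤ degreeSum G := by
        have := Nat.mul_le_mul_left K hWq
        nlinarith
      have hM5 : degreeSum G ≤ 5 * K ^ 2 := by
        have : K * D + 6 * K ≤ 3 * K ^ 2 := by
          have := Nat.mul_le_mul_left K (by omega : D + 6 ≤ 3 * K)
          linarith
        omega
      rcases j with _ | j
      · obtain rfl : ε = 0 := by omega
        have := cherries_numerics (by omega) hr (by omega) hsum₁ hM5 hMK hX
        have h2 : 2 * lexStars 2 0 (h + 1) r s = _ := two_mul_lexStars_two (h + 1) r s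
        rw [zero_add]
        omega
      · obtain ⟨N, hN⟩ : ∃ N, N + 3 = h + 1 + r + s + 1 := ⟨h + r + s - 1, by omega⟩
        have := larger_stars_numerics (by omega) (by omega) hN hsum₁ hMK hX (by omega)
          (by omega : D + 1 ≤ 3 * K)
        have h2 := numStars_le_of_cherries (j := j) (ε := ε) (by omega) hD (by omega) (by omega)
          (by omega) this
        refine h2.trans ?_
        rw [show N + 2 = h + 1 + r + s by omega]
        unfold lexStars
        have e : j + 1 + 2 = j + 3 := rfl
        rw [e]
        omega

end Main

/-! ### The graph of an initial segment of the lexicographic order -/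

section LexGraph
open Finset
open scoped Classical

/-- The pairs `a < b` of numbers at least `j` with `a < h`, or with `a = h` and `b ≤ h + r`. For
`j = 0` this is an initial segment of the lexicographic order. -/
def LexPair {n : ℕ} (j h r : ℕ) (a b : Fin n) : Prop :=
  a < b ∧ j ≤ (a : ℕ) ∧ ((a : ℕ) < h ∨ (a : ℕ) = h ∧ (b : ℕ) ≤ h + r)

/-- The graph whose edges are the pairs described by `LexPair`. -/
def lexGraph (n j h r : ℕ) : SimpleGraph (Fin n) where
  Adj a b := LexPair j h r a b ∨ LexPair j h r b a
  symm := ⟨fun _ _ h => h.symm⟩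
  loopless := ⟨fun a h => by rcases h with h | h <;> exact lt_irrefl _ h.1⟩

variable {n h r s : ℕ}

lemma lexGraph_base (hn : n = h + r + s + 1) :
    lexGraph n h h r = addStar (⊥ : SimpleGraph (Fin n)) ⟨h, by omega⟩
      {b | h < (b : ℕ) ∧ (b : ℕ) ≤ h + r} := by
  ext a b
  simp only [lexGraph, LexPair, addStar, SimpleGraph.bot_adj, mem_filter, mem_univ, true_and,
    Fin.ext_iff, Fin.lt_def, ne_eq, false_or]
  omega

lemma lexGraph_step {j : ℕ} (hn : n = h + r + s + 1) (hj : j < h) :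
    lexGraph n j h r = addStar (lexGraph n (j + 1) h r) ⟨j, by omega⟩ {b | j < (b : ℕ)} := by
  ext a b
  simp only [lexGraph, LexPair, addStar, mem_filter, mem_univ, true_and, Fin.ext_iff, Fin.lt_def,
    ne_eq]
  omega

lemma card_filter_lt {j : ℕ} (hj : j < n) :
    #{b : Fin n | j < (b : ℕ)} = n - 1 - j := by
  have : ({b : Fin n | j < (b : ℕ)} : Finset (Fin n)) = Ioi ⟨j, hj⟩ := by
    ext b; simp [Fin.lt_def]
  rw [this, Fin.card_Ioi]

lemma card_filter_Ioc (hn : n = h + r + s + 1) :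
    #{b : Fin n | h < (b : ℕ) ∧ (b : ℕ) ≤ h + r} = r := by
  have : ({b : Fin n | h < (b : ℕ) ∧ (b : ℕ) ≤ h + r} : Finset (Fin n)) =
      Ioc ⟨h, by omega⟩ ⟨h + r, by omega⟩ := by
    ext b; simp [Fin.lt_def, Fin.le_def]
  rw [this, Fin.card_Ioc]
  simp

/-- The star counts of `lexGraph`. Its vertex `j < h` is joined to all later vertices, so deleting it
leaves `lexGraph` with `j + 1` in place of `j`. -/
lemma lexGraph_counts (hn : n = h + r + s + 1) (t : ℕ) : ∀ j, j + t = h →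
    degreeSum (lexGraph n j h r) = lexStars 1 0 t r s ∧
      ∀ k ε, numStars (k + 2) ε (lexGraph n j h r) = lexStars (k + 2) ε t r s := by
  induction t with
  | zero =>
    rintro j rfl
    rw [add_zero] at hn ⊢
    have hx : (⟨j, by omega⟩ : Fin n) ∉
        ({b | j < (b : ℕ) ∧ (b : ℕ) ≤ j + r} : Finset (Fin n)) := by simp
    rw [lexGraph_base hn]
    constructor
    · rw [degreeSum_addStar hx (by simp), card_filter_Ioc hn]
      simp [degreeSum, lexStars]
      ring
    · intro k ε
      have hbot : ∀ i, numStars (i + 1) 0 (⊥ : SimpleGraph (Fin n)) = 0 := fun i => by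
        simp [numStars]
      have hbot' : numStars (k + 2) ε (⊥ : SimpleGraph (Fin n)) = 0 := by
        have h1 := hbot (k + 1)
        have h2 := card_triangles_le (G := (⊥ : SimpleGraph (Fin n)))
        rw [hbot, Nat.le_zero] at h2
        simp only [numStars, zero_mul, add_zero] at h1 ⊢
        rw [h1, h2]
        rfl
      have h3 := numStars_cone (G := (⊥ : SimpleGraph (Fin n))) hx
        (fun a b hab => absurd hab (by simp)) k ε
      have h4 : degreeSum (⊥ : SimpleGraph (Fin n)) = 0 := by simp [degreeSum]
      rw [card_filter_Ioc hn, hbot, hbot', h4] at h3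
      simp only [lexStars, Nat.choose_eq_zero_of_lt (by omega : 0 + 1 < k + 2), Nat.choose_zero_succ,
        zero_mul, zero_add, mul_zero, add_zero, Nat.choose_zero_succ] at h3 ⊢
      omega
  | succ t ih =>
    intro j hj
    obtain ⟨h1, h2⟩ := ih (j + 1) (by omega)
    have hx : (⟨j, by omega⟩ : Fin n) ∉ ({b | j < (b : ℕ)} : Finset (Fin n)) := by simp
    have hsup : SupportedOn (lexGraph n (j + 1) h r) {b | j < (b : ℕ)} := by
      intro a b hab
      simp only [lexGraph, LexPair, Fin.lt_def] at hab
      simp only [mem_filter, mem_univ, true_and]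
      omega
    have hcard := card_filter_lt (by omega : j < n)
    rw [show n - 1 - j = t + 1 + r + s by omega] at hcard
    rw [lexGraph_step hn (by omega)]
    constructor
    · rw [degreeSum_addStar hx (fun b hb hadj => hx (hsup _ _ hadj)), h1, hcard]
      have e1 := lexStars_one t r s
      have e2 := lexStars_one (t + 1) r s
      nlinarith
    · intro k ε
      have h3 := numStars_cone hx hsup k ε
      have h4 := lexStars_succ k ε t r s
      have h5 : numStars (k + 1) 0 (lexGraph n (j + 1) h r) = lexStars (k + 1) 0 t r s := by
        rcases k with _ | k
        · rw [← h1]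
          simp [numStars, degreeSum]
        · exact h2 k 0
      rw [hcard, h2, h5, h1] at h3
      linarith

/-- `numStars` with the neighbourhoods and the set of triangles given by membership, independently of
decidability instances. -/
lemma numStars_eq {V : Type*} [Fintype V] (k ε : ℕ) (G : SimpleGraph V) {T : Finset (Finset V)}
    (hT : ∀ s, s ∈ T ↔ G.IsNClique 3 s) :
    numStars k ε G = ∑ v, (#{w | G.Adj v w}).choose k + ε * #T := by
  have h1 : ∀ v, G.degree v = #{w | G.Adj v w} := fun v => by
    rw [← G.card_neighborFinset_eq_degree]
    congr 1
    ext w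
    simp
  have h2 : G.cliqueFinset 3 = T := by
    ext s
    rw [SimpleGraph.mem_cliqueFinset_iff, hT]
  rw [numStars, h2, sum_congr rfl fun v _ => congrArg (fun d => d.choose k) (h1 v)]

end LexGraph

/-! ### Intersecting families of pairs -/

section Families
open Finset
open scoped Classical

variable {V : Type*} [DecidableEq V]

/-- The graph with edge set `F`. -/
def familyGraph (F : Finset (Finset V)) : SimpleGraph V where
  Adj a b := a ≠ b ∧ {a, b} ∈ F
  symm := ⟨fun a b h => ⟨h.1.symm, by rw [pair_comm]; exact h.2⟩⟩
  loopless := ⟨fun _ h => h.1 rfl⟩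

/-- The number of intersecting subfamilies of `F` with `k` members. -/
noncomputable def intersectingCount (k : ℕ) (F : Finset (Finset V)) : ℕ :=
  #((F.powersetCard k).filter fun H : Finset (Finset V) => (H : Set (Finset V)).Intersecting)

/-- An intersecting family of at least two pairs is a star or a triangle. -/
lemma star_or_triangle {H : Finset (Finset V)} (hH : (H : Set (Finset V)).Intersecting)
    (h2 : ∀ A ∈ H, #A = 2) (hcard : 2 ≤ #H) :
    (∃ v, ∀ A ∈ H, v ∈ A) ∨ ∃ s : Finset V, #s = 3 ∧ H = s.powersetCard 2 := by
  have hmeet : ∀ A ∈ H, ∀ B ∈ H, ∃ v, v ∈ A ∧ v ∈ B := fun A hA B hB =>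
    not_disjoint_iff.1 (hH hA hB)
  obtain ⟨A, hA, B, hB, hAB⟩ := one_lt_card.1 hcard
  rw [or_iff_not_imp_left]
  intro hno
  push Not at hno
  obtain ⟨a, haA, haB⟩ := hmeet A hA B hB
  have pair : ∀ {A : Finset V}, A ∈ H → ∀ {v}, v ∈ A → ∃ w, w ≠ v ∧ A = {v, w} := by
    intro A hA v hv
    obtain ⟨x, y, hxy, rfl⟩ := card_eq_two.1 (h2 A hA)
    simp only [mem_insert, mem_singleton] at hv
    rcases hv with rfl | rfl
    · exact ⟨y, hxy.symm, rfl⟩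
    · exact ⟨x, hxy, pair_comm _ _⟩
  obtain ⟨b, hba, rfl⟩ := pair hA haA
  obtain ⟨c, hca, rfl⟩ := pair hB haB
  have hbc : b ≠ c := fun e => hAB (by rw [e])
  obtain ⟨C, hC, haC⟩ := hno a
  have hbC : b ∈ C := by
    obtain ⟨v, hv, hvC⟩ := hmeet _ hA _ hC
    simp only [mem_insert, mem_singleton] at hv
    rcases hv with rfl | rfl
    · exact absurd hvC haC
    · exact hvC
  have hcC : c ∈ C := by
    obtain ⟨v, hv, hvC⟩ := hmeet _ hB _ hC
    simp only [mem_insert, mem_singleton] at hv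
    rcases hv with rfl | rfl
    · exact absurd hvC haC
    · exact hvC
  obtain ⟨c', hc', rfl⟩ := pair hC hbC
  obtain rfl : c = c' := by
    simp only [mem_insert, mem_singleton] at hcC
    exact hcC.resolve_left hbc.symm
  have hs : #({a, b, c} : Finset V) = 3 := card_eq_three.2 ⟨a, b, c, hba.symm, hca.symm, hbc, rfl⟩
  refine ⟨{a, b, c}, hs, ?_⟩
  have hsub : H ⊆ ({a, b, c} : Finset V).powersetCard 2 := by
    intro D hD
    rw [mem_powersetCard]
    refine ⟨?_, h2 D hD⟩
    obtain ⟨u, hu, huD⟩ := hmeet _ hA _ hD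
    obtain ⟨v, hv, hvD⟩ := hmeet _ hB _ hD
    obtain ⟨w, hw, hwD⟩ := hmeet _ hC _ hD
    obtain ⟨x, y, hxy, rfl⟩ := card_eq_two.1 (h2 D hD)
    intro z hz
    simp only [mem_insert, mem_singleton] at *
    grind
  refine eq_of_subset_of_card_le hsub ?_
  rw [card_powersetCard, hs]
  refine (card_eq_three.2 ⟨{a, b}, {a, c}, {b, c}, hAB, ?_, ?_, rfl⟩).symm.trans_le
    (card_le_card ?_)
  · intro e
    rw [← e] at haC
    simp at haC
  · intro e
    rw [← e] at haC
    simp at haC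
  · intro D hD
    simp only [mem_insert, mem_singleton] at hD
    rcases hD with rfl | rfl | rfl <;> assumption

variable [Fintype V]

variable {F : Finset (Finset V)}

lemma card_adj_familyGraph (hF : ∀ A ∈ F, #A = 2) (v : V) :
    #{w | (familyGraph F).Adj v w} = #{A ∈ F | v ∈ A} := by
  refine card_bij (fun w _ => {v, w}) ?_ ?_ ?_
  · intro w hw
    simp only [mem_filter, mem_univ, true_and] at hw
    simpa using hw.2
  · intro w hw w' hw' he
    simp only [mem_filter, mem_univ, true_and] at hw hw'
    have : w ∈ ({v, w'} : Finset V) := he ▸ (by simp)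
    simp only [mem_insert, mem_singleton] at this
    exact this.resolve_left hw.1.symm
  · intro A hA
    rw [mem_filter] at hA
    obtain ⟨x, y, hxy, rfl⟩ := card_eq_two.1 (hF A hA.1)
    have hv := hA.2
    simp only [mem_insert, mem_singleton] at hv
    rcases hv with rfl | rfl
    · exact ⟨y, mem_filter.2 ⟨mem_univ _, hxy, hA.1⟩, rfl⟩
    · exact ⟨x, mem_filter.2 ⟨mem_univ _, hxy.symm, by rw [pair_comm]; exact hA.1⟩, pair_comm _ _⟩

lemma degreeSum_familyGraph (hF : ∀ A ∈ F, #A = 2) : degreeSum (familyGraph F) = 2 * #F := by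
  have h1 := numStars_eq 1 0 (familyGraph F) (T := {s | (familyGraph F).IsNClique 3 s}) (by simp)
  simp only [numStars, Nat.choose_one_right, zero_mul, add_zero] at h1
  rw [degreeSum, h1, sum_congr rfl fun v _ => card_adj_familyGraph hF v]
  have h2 := sum_card_bipartiteAbove_eq_sum_card_bipartiteBelow
    (s := (univ : Finset V)) (t := F) (fun v A => v ∈ A)
  simp only [bipartiteAbove, bipartiteBelow, filter_univ_mem] at h2
  rw [h2, sum_congr rfl hF, sum_const, smul_eq_mul, mul_comm]

/-- The intersecting subfamilies with at least two members are the stars and the triangles. -/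
lemma intersectingCount_eq_numStars (hF : ∀ A ∈ F, #A = 2) (k : ℕ) :
    intersectingCount (k + 2) F = numStars (k + 2) (if k = 1 then 1 else 0) (familyGraph F) := by
  set T : Finset (Finset V) := {s | (familyGraph F).IsNClique 3 s} with hT
  have hTF : ∀ s ∈ T, s.powersetCard 2 ⊆ F ∧ #s = 3 := by
    intro s hs
    simp only [hT, mem_filter, mem_univ, true_and, SimpleGraph.isNClique_iff] at hs
    refine ⟨fun A hA => ?_, hs.2⟩
    rw [mem_powersetCard] at hA
    obtain ⟨x, y, hxy, rfl⟩ := card_eq_two.1 hA.2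
    exact (hs.1 (hA.1 (by simp)) (hA.1 (by simp)) hxy).2
  have heq : (F.powersetCard (k + 2)).filter
      (fun H : Finset (Finset V) => (H : Set (Finset V)).Intersecting) =
      (univ.biUnion fun v => {A ∈ F | v ∈ A}.powersetCard (k + 2)) ∪
        (if k = 1 then T.image fun s => s.powersetCard 2 else ∅) := by
    ext H
    simp only [mem_filter, mem_powersetCard, mem_union, mem_biUnion, mem_univ, true_and]
    constructor
    · rintro ⟨⟨hHF, hHc⟩, hH⟩
      rcases star_or_triangle hH (fun A hA => hF A (hHF hA)) (by omega) with ⟨v, hv⟩ | ⟨s, hs, rfl⟩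
      · exact Or.inl ⟨v, fun A hA => mem_filter.2 ⟨hHF hA, hv A hA⟩, hHc⟩
      · right
        rw [card_powersetCard, hs] at hHc
        have hk : k = 1 := by
          have : Nat.choose 3 2 = 3 := rfl
          omega
        rw [if_pos hk]
        refine mem_image.2 ⟨s, ?_, rfl⟩
        simp only [hT, mem_filter, mem_univ, true_and, SimpleGraph.isNClique_iff]
        refine ⟨fun a ha b hb hab => ⟨hab, hHF (mem_powersetCard.2 ⟨?_, card_pair hab⟩)⟩, hs⟩
        intro x hx
        simp only [mem_insert, mem_singleton] at hx
        rcases hx with rfl | rfl <;> assumption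
    · rintro (⟨v, hHF, hHc⟩ | hH)
      · refine ⟨⟨fun A hA => (mem_filter.1 (hHF hA)).1, hHc⟩, fun A hA B hB => ?_⟩
        exact not_disjoint_iff.2 ⟨v, (mem_filter.1 (hHF hA)).2, (mem_filter.1 (hHF hB)).2⟩
      · split_ifs at hH with hk
        · obtain ⟨s, hs, rfl⟩ := mem_image.1 hH
          obtain ⟨h1, h2⟩ := hTF s hs
          refine ⟨⟨h1, by rw [card_powersetCard, h2, hk]; rfl⟩, fun A hA B hB hAB => ?_⟩
          have hA' := mem_powersetCard.1 (mem_coe.1 hA)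
          have hB' := mem_powersetCard.1 (mem_coe.1 hB)
          have := card_le_card (union_subset hA'.1 hB'.1)
          rw [card_union_of_disjoint hAB] at this
          omega
        · simp at hH
  rw [intersectingCount, heq, card_union_of_disjoint, card_biUnion,
    numStars_eq _ _ _ (T := T) (by simp [hT])]
  · congr 1
    · refine sum_congr rfl fun v _ => ?_
      rw [card_powersetCard, card_adj_familyGraph hF]
    · split_ifs
      · rw [one_mul, card_image_of_injOn]
        intro s hs t ht hst
        have hsup : ∀ s ∈ T, (s.powersetCard 2).biUnion id = s := by
          intro s hs
          obtain ⟨a, b, c, hab, hac, hbc, rfl⟩ := card_eq_three.1 (hTF s hs).2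
          ext x
          simp only [mem_biUnion, mem_powersetCard, id]
          constructor
          · rintro ⟨A, ⟨hA, -⟩, hx⟩
            exact hA hx
          · intro hx
            obtain ⟨y, hy, hyx⟩ := exists_mem_ne (by rw [(hTF _ hs).2]; omega) x
            refine ⟨{x, y}, ⟨?_, card_pair hyx.symm⟩, by simp⟩
            intro z hz
            rcases mem_insert.1 hz with rfl | hz
            · exact hx
            · rwa [mem_singleton.1 hz]
        rw [← hsup s hs, ← hsup t ht]
        exact congrArg (fun P => P.biUnion id) hst
      · simp
  -- two centres share at most one pair
  · intro v _ w _ hvw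
    simp only [Function.onFun]
    rw [disjoint_left]
    intro H hv hw
    rw [mem_powersetCard] at hv hw
    have key : ∀ A ∈ H, A = {v, w} := by
      intro A hA
      have h1 := mem_filter.1 (hv.1 hA)
      have h2 := mem_filter.1 (hw.1 hA)
      refine (eq_of_subset_of_card_le ?_ (by rw [hF A h1.1, card_pair hvw])).symm
      intro x hx
      simp only [mem_insert, mem_singleton] at hx
      rcases hx with rfl | rfl
      · exact h1.2
      · exact h2.2
    obtain ⟨A, hA, B, hB, hAB⟩ := one_lt_card.1 (by omega : 1 < #H)
    exact hAB ((key A hA).trans (key B hB).symm)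
  · rw [disjoint_left]
    intro H hstar htri
    split_ifs at htri with hk
    · obtain ⟨s, hs, rfl⟩ := mem_image.1 htri
      obtain ⟨v, -, hv⟩ := mem_biUnion.1 hstar
      rw [mem_powersetCard] at hv
      have h3 := (hTF s hs).2
      have hcard : 2 ≤ #(s.erase v) := by
        have := pred_card_le_card_erase (s := s) (a := v)
        omega
      obtain ⟨A, hA, hAc⟩ := exists_subset_card_eq hcard
      have := mem_filter.1 (hv.1 (mem_powersetCard.2 ⟨hA.trans (erase_subset _ _), hAc⟩))
      exact notMem_erase v s (hA this.2)
    · simp at htri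

end Families

/-! ### Initial segments of the lexicographic order -/

section LexFamily
open Finset

variable {n : ℕ}

lemma lexLT_pair_iff {a b c d : Fin n} (hab : a < b) (hcd : c < d) :
    LexLT ({a, b} : Finset (Fin n)) {c, d} ↔ a < c ∨ a = c ∧ b < d := by
  simp only [LexLT, mem_symmDiff, mem_insert, mem_singleton]
  constructor
  · rintro ⟨x, hx, hmin, hxA⟩
    have h1 := hmin c
    have h2 := hmin d
    grind
  · rintro (h | ⟨rfl, h⟩)
    · exact ⟨a, by grind, by grind, Or.inl rfl⟩
    · exact ⟨b, by grind, by grind, Or.inr rfl⟩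

lemma exists_lt_pair {A : Finset (Fin n)} (hA : #A = 2) : ∃ a b, a < b ∧ A = {a, b} := by
  obtain ⟨x, y, hxy, rfl⟩ := card_eq_two.1 hA
  rcases lt_or_gt_of_ne hxy with h | h
  · exact ⟨x, y, h, rfl⟩
  · exact ⟨y, x, h, pair_comm _ _⟩

instance (j h r : ℕ) : DecidableRel (LexPair (n := n) j h r) := fun a b => by
  unfold LexPair
  infer_instance

/-- The edge set of `lexGraph n 0 h r`. -/
def lexSegment (n h r : ℕ) : Finset (Finset (Fin n)) :=
  {A ∈ powersetCard 2 univ | ∃ a b, LexPair 0 h r a b ∧ A = {a, b}}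

lemma card_of_mem_lexSegment {h r : ℕ} {A : Finset (Fin n)} (hA : A ∈ lexSegment n h r) :
    #A = 2 := (mem_powersetCard.1 (mem_filter.1 hA).1).2

lemma pair_eq_pair {a b c d : Fin n} (hab : a < b) (hcd : c < d)
    (h : ({a, b} : Finset (Fin n)) = {c, d}) : a = c ∧ b = d := by
  have h1 : a ∈ ({c, d} : Finset (Fin n)) := h ▸ (by simp)
  have h2 : b ∈ ({c, d} : Finset (Fin n)) := h ▸ (by simp)
  have h3 : c ∈ ({a, b} : Finset (Fin n)) := h ▸ (by simp)
  simp only [mem_insert, mem_singleton, Fin.ext_iff, Fin.lt_def] at *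
  omega

lemma mem_lexSegment {h r : ℕ} {a b : Fin n} (hab : a < b) :
    {a, b} ∈ lexSegment n h r ↔ LexPair 0 h r a b := by
  simp only [lexSegment, mem_filter, mem_powersetCard, subset_univ, true_and, card_pair hab.ne]
  constructor
  · rintro ⟨c, d, hcd, he⟩
    obtain ⟨rfl, rfl⟩ := pair_eq_pair hab hcd.1 he
    exact hcd
  · exact fun h => ⟨a, b, h, rfl⟩

lemma familyGraph_lexSegment (h r : ℕ) : familyGraph (lexSegment n h r) = lexGraph n 0 h r := by
  ext a b
  simp only [familyGraph, lexGraph]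
  rcases lt_trichotomy a b with hab | rfl | hab
  · rw [mem_lexSegment hab]
    exact ⟨fun h => Or.inl h.2, fun h => ⟨hab.ne, h.resolve_right fun h' => lt_asymm hab h'.1⟩⟩
  · exact ⟨fun h => absurd rfl h.1, fun h => by
      rcases h with h | h <;> exact absurd h.1 (lt_irrefl _)⟩
  · rw [pair_comm, mem_lexSegment hab]
    exact ⟨fun h => Or.inr h.2, fun h => ⟨hab.ne', h.resolve_left fun h' => lt_asymm hab h'.1⟩⟩

/-- An initial segment of the lexicographic order with `m` members is the family of the first `m`
pairs. -/
lemma lexFamily_eq_lexSegment {h r m : ℕ} (hm : #(lexSegment n h r) = m) :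
    lexFamily n 2 m = lexSegment n h r := by
  classical
  ext A
  constructor
  · intro hA
    rw [lexFamily, mem_filter] at hA
    obtain ⟨hA, hlt⟩ := hA
    by_contra hAs
    refine hlt.not_ge (hm ▸ card_le_card fun B hB => ?_)
    refine mem_filter.2 ⟨(mem_filter.1 hB).1, ?_⟩
    obtain ⟨a, b, hab, rfl⟩ := exists_lt_pair (mem_powersetCard.1 hA).2
    obtain ⟨c, d, hcd, rfl⟩ := exists_lt_pair (card_of_mem_lexSegment hB)
    rw [mem_lexSegment hab] at hAs
    rw [mem_lexSegment hcd] at hB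
    rw [lexLT_pair_iff hcd hab]
    simp only [LexPair, Fin.lt_def, Fin.ext_iff] at *
    omega
  · intro hA
    have hA2 := (mem_filter.1 hA).1
    rw [lexFamily, mem_filter]
    refine ⟨hA2, hm ▸ card_lt_card ((ssubset_iff_of_subset fun B hB => ?_).2 ⟨A, hA, fun h => ?_⟩)⟩
    · obtain ⟨hB2, hlt⟩ := mem_filter.1 hB
      obtain ⟨a, b, hab, rfl⟩ := exists_lt_pair (mem_powersetCard.1 hA2).2
      obtain ⟨c, d, hcd, rfl⟩ := exists_lt_pair (mem_powersetCard.1 hB2).2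
      rw [mem_lexSegment hab] at hA
      rw [mem_lexSegment hcd]
      rw [lexLT_pair_iff hcd hab] at hlt
      simp only [LexPair, Fin.lt_def, Fin.ext_iff] at *
      omega
    · obtain ⟨x, hx, -⟩ := (mem_filter.1 h).2
      simp at hx

/-- Every `m` in the range of the theorem is `h` full centres plus `r` further edges. -/
lemma exists_lex_parameters {m : ℕ} (hm0 : 1 ≤ m) (ℓ : ℕ) (hm : 2 * m + ℓ * (ℓ + 1) ≤ 2 * ℓ * n) :
    ∃ h r s, h < ℓ ∧ n = h + r + s + 1 ∧ 1 ≤ r ∧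
      2 * m + h * (h + 1) = 2 * h * (h + r + s + 1) + 2 * r := by
  induction ℓ with
  | zero => omega
  | succ ℓ ih =>
    rcases le_or_gt (2 * m + ℓ * (ℓ + 1)) (2 * ℓ * n) with h | h
    · obtain ⟨h', r, s, h1, h2⟩ := ih h
      exact ⟨h', r, s, by omega, h2⟩
    · obtain ⟨e, he⟩ := (Nat.even_mul_succ_self ℓ)
      obtain ⟨r, hr⟩ : ∃ r, m + e = ℓ * n + r := ⟨m + e - ℓ * n, by
        have : 2 * ℓ * n = 2 * (ℓ * n) := by ring
        omega⟩
      have h3 : ℓ + r + 1 ≤ n := by nlinarith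
      refine ⟨ℓ, r, n - (ℓ + r + 1), by omega, by omega, by nlinarith, ?_⟩
      rw [show ℓ + r + (n - (ℓ + r + 1)) + 1 = n by omega]
      nlinarith

end LexFamily

/-! ### The probability as a sum over intersecting subfamilies -/

section Probability
open Finset
open scoped Classical

variable {n : ℕ} {F : Finset (Finset (Fin n))}

lemma probIntersecting_eq_sum (p : unitInterval) : probIntersecting F p =
    ∑ k ∈ range (#F + 1), intersectingCount k F * ((p : ℝ) ^ k * (1 - p : ℝ) ^ (#F - k)) := by
  have hset : {G : Set (Finset (Fin n)) | G.Intersecting ∧ G ⊆ F} =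
      ⋃ H ∈ F.powerset.filter (fun H : Finset (Finset (Fin n)) =>
        (H : Set (Finset (Fin n))).Intersecting), {(H : Set (Finset (Fin n)))} := by
    ext G
    simp only [Set.mem_ofPred_eq, Set.mem_iUnion, mem_filter, mem_powerset, Set.mem_singleton_iff]
    constructor
    · rintro ⟨hG, hGF⟩
      refine ⟨G.toFinite.toFinset, ⟨?_, by simpa using hG⟩, by simp⟩
      simpa using hGF
    · rintro ⟨H, ⟨hHF, hH⟩, rfl⟩
      exact ⟨hH, by simpa using hHF⟩
  have h1 : probIntersecting F p =
      ∑ H ∈ F.powerset.filter (fun H : Finset (Finset (Fin n)) =>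
        (H : Set (Finset (Fin n))).Intersecting), (p : ℝ) ^ #H * (1 - p : ℝ) ^ (#F - #H) := by
    rw [probIntersecting, MeasureTheory.measureReal_def,
      ProbabilityTheory.setBernoulli_apply_eq_apply_subsets, ← MeasureTheory.measureReal_def]
    simp only [Set.mem_ofPred_eq]
    rw [hset, MeasureTheory.measureReal_biUnion_finset]
    · refine sum_congr rfl fun H hH => ?_
      have hHF := mem_powerset.1 (mem_filter.1 hH).1
      rw [ProbabilityTheory.setBernoulli_real_singleton p (by simpa using hHF) F.finite_toSet,
        ← coe_sdiff, Set.ncard_coe_finset, Set.ncard_coe_finset, card_sdiff_of_subset hHF]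
    · intro H _ H' _ hne
      simpa [Function.onFun] using hne
    · simp
  rw [h1, ← sum_fiberwise_of_maps_to (g := card) (t := range (#F + 1))]
  · refine sum_congr rfl fun k _ => ?_
    have h2 : (F.powerset.filter (fun H : Finset (Finset (Fin n)) =>
        (H : Set (Finset (Fin n))).Intersecting)).filter (fun H => #H = k) =
        (F.powersetCard k).filter
          (fun H : Finset (Finset (Fin n)) => (H : Set (Finset (Fin n))).Intersecting) := by
      ext H
      simp only [mem_filter, mem_powerset, mem_powersetCard]
      tauto
    rw [h2, sum_congr rfl fun H hH => by
      rw [(mem_powersetCard.1 (mem_filter.1 hH).1).2], sum_const, nsmul_eq_mul]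
    rfl
  · intro H hH
    have := card_le_card (mem_powerset.1 (mem_filter.1 hH).1)
    simp only [mem_range]
    omega

lemma intersectingCount_zero : intersectingCount 0 F = 1 := by
  simp [intersectingCount, filter_singleton, Set.intersecting_empty]

lemma intersectingCount_one (hF : ∀ A ∈ F, #A = 2) : intersectingCount 1 F = #F := by
  rw [intersectingCount, filter_true_of_mem, card_powersetCard, Nat.choose_one_right]
  intro H hH
  obtain ⟨hHF, hc⟩ := mem_powersetCard.1 hH
  obtain ⟨A, rfl⟩ := card_eq_one.1 hc
  have h2 := hF A (hHF (by simp))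
  rw [coe_singleton, Set.intersecting_singleton, bot_eq_empty, ne_eq, ← card_eq_zero]
  omega

lemma probIntersecting_le {F' : Finset (Finset (Fin n))} (hcard : #F = #F')
    (h : ∀ k, intersectingCount k F ≤ intersectingCount k F') (p : unitInterval) :
    probIntersecting F p ≤ probIntersecting F' p := by
  rw [probIntersecting_eq_sum, probIntersecting_eq_sum, hcard]
  refine sum_le_sum fun k _ => mul_le_mul_of_nonneg_right (by exact_mod_cast h k) ?_
  have h1 := p.2.1
  have h2 : (0 : ℝ) ≤ 1 - p := sub_nonneg.2 p.2.2
  positivity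

end Probability

theorem theorem1p3 (n ℓ m : ℕ) (hn : 32 * ℓ ≤ n)
    (hm : m ≤ n.choose 2 - (n - ℓ).choose 2) :
    ∀ p : unitInterval, IsMostProbablyIntersecting 2 m p (lexFamily n 2 m) := by
  intro p
  rcases Nat.eq_zero_or_pos m with rfl | hm0
  · have h0 : lexFamily n 2 0 = ∅ := by simp [lexFamily]
    rw [h0]
    refine ⟨⟨by simp, by simp⟩, fun F' hF' => ?_⟩
    rw [Finset.card_eq_zero.1 hF'.2]
  have hm' : 2 * m + ℓ * (ℓ + 1) ≤ 2 * ℓ * n := by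
    obtain ⟨N, rfl⟩ : ∃ N, n = ℓ + N := ⟨n - ℓ, by omega⟩
    rw [Nat.add_sub_cancel_left] at hm
    have h1 := two_mul_choose_two (ℓ + N)
    have h2 := two_mul_choose_two N
    have h3 : 2 * m + N * (N - 1) ≤ (ℓ + N) * (ℓ + N - 1) := by omega
    rcases ℓ with _ | ℓ
    · simp at hm; omega
    · rw [show ℓ + 1 + N - 1 = ℓ + N by omega] at h3
      rcases N with _ | N
      · nlinarith
      · rw [Nat.add_sub_cancel] at h3
        nlinarith
  obtain ⟨h, r, s, hhℓ, hnr, hr, hmr⟩ := exists_lex_parameters hm0 ℓ hm'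
  obtain ⟨hdeg, hstars⟩ := lexGraph_counts hnr h 0 (by omega)
  have hLF : ∀ A ∈ lexSegment n h r, A.card = 2 := fun A hA => card_of_mem_lexSegment hA
  have hcard : (lexSegment n h r).card = m := by
    have h1 := degreeSum_familyGraph hLF
    rw [familyGraph_lexSegment, hdeg] at h1
    have h2 := lexStars_one h r s
    omega
  rw [lexFamily_eq_lexSegment hcard]
  refine ⟨⟨hLF, hcard⟩, fun F hF => probIntersecting_le (hF.2.trans hcard.symm) (fun k => ?_) p⟩
  match k with
  | 0 => rw [intersectingCount_zero, intersectingCount_zero]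
  | 1 => rw [intersectingCount_one hF.1, intersectingCount_one hLF, hF.2, hcard]
  | j + 2 =>
    rw [intersectingCount_eq_numStars hF.1, intersectingCount_eq_numStars hLF,
      familyGraph_lexSegment, hstars]
    refine numStars_le_lexStars h ?_ (Or.inr ⟨hr, by omega⟩) Finset.univ _
      (by rw [Finset.card_univ, Fintype.card_fin, hnr]) (fun _ _ _ => Finset.mem_univ _) ?_
    · split_ifs with hj
      · exact Or.inr ⟨rfl, hj⟩
      · exact Or.inl rfl
    · rw [degreeSum_familyGraph hF.1, hF.2, hmr]
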